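/- **Setting.** Let $G$ be a finite simple graph embedded in an oriented surface (up to homeomorphism, i.e. given by a rotation system), with a distinguished set $F$ of faces, called internal, all of degree $4$. Each oriented edge lies on the boundary of at most one internal face on its right, and the corners of $f\in F$ are named $x^f,u^f,y^f,v^f$ in clockwise order. (Examples: a quadrangulation of the sphere, with all faces internal; a finite planar quadrangulation with boundary, whose internal faces are the bounded ones.) An edge with an internal face on exactly one side is called external. *Marked $C_2^{(1)}$ loop configurations.* In each internal face the midpoints of the four sides $xu,uy,yv,vx$ are connected in pairs by two colored (red or blue) paths in one of ten ways: $1_a,1_b$: $xu$–$uy$ and $yv$–$vx$, both red or both blue; $2_a,2_b$: $vx$–$xu$ and $uy$–$yv$, both red or both blue; $3_a,3_b$: connected as in $1$, with two different colors; $4_a,4_b$: connected as in $2$, with two different colors; $5_a,5_b$: $xu$–$yv$ and $uy$–$vx$, crossing, with two different colors. A marked configuration $\sigma$ is a choice of such a local configuration in every internal face such that colors agree across every edge, together with an index at every edge bordering an internal face, $0$ or $2$ if the path there is red, $A$ or $B$ if it is blue. Along a path the index stays constant when it goes through a face without crossing, and changes to the other index of the same color when the path crosses a path of the other color. *Weights.*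 For positive variables $g=(g_v)_{v\in V}$, the weight of $\sigma$ is the product over $f\in F$ of $w^f_i$, where $i$ is the type of $\sigma$ at $f$ and $$w^f_1=g_xg_y,\quad w^f_2=g_ug_v,\quad w^f_3=\sqrt{g_xg_y}\sqrt{g_xg_y+g_ug_v},\quad w^f_4=\sqrt{g_ug_v}\sqrt{g_xg_y+g_ug_v},\quad w^f_5=\sqrt{g_xg_yg_ug_v}.$$ A boundary condition $\beta$ is any condition on the colors and indices at the external edges and on which external edges are connected by paths (possibly no condition). Let $\mathcal Z^{G}_\beta(g)$ be the sum of the weights of all marked configurations satisfying $\beta$. *Cube flip.* Let $x$ be a vertex of degree $3$ with neighbors $v_1,v_2,v_3$, surrounded by three internal faces with clockwise boundaries $(x,v_3,v_{23},v_2)$, $(x,v_1,v_{13},v_3)$, $(x,v_2,v_{12},v_1)$, the seven vertices being distinct. The cube flip at $x$ gives the graph $G'$ in which, inside the hexagon $v_3v_{23}v_2v_{12}v_1v_{13}$, $x$ is joined to $v_{12},v_{13},v_{23}$ instead, so that the three faces are replaced by the internal faces $(x,v_{12},v_1,v_{13})$, $(x,v_{23},v_2,v_{12})$, $(x,v_{13},v_3,v_{23})$;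 everything else is unchanged. Let $g'_x>0$, and let $g'$ be equal to $g$ except at $x$, where its value is $g'_x$. Write $g_i=g_{v_i}$, $g_{ij}=g_{v_{ij}}$. We say that $g$ satisfies Kashaev's recurrence at $x$ if $$g'_x=\frac{2g_1g_2g_3+g_x(g_1g_{23}+g_2g_{13}+g_3g_{12})+2XYZ}{g_x^2},$$ where $X=\sqrt{g_xg_{23}+g_2g_3}$, $Y=\sqrt{g_xg_{13}+g_1g_3}$, $Z=\sqrt{g_xg_{12}+g_1g_2}$. **Theorem.** (1) If $g$ satisfies Kashaev's recurrence at $x$, then for every boundary condition $\beta$, $$\frac{1}{g_x^2}\,\mathcal Z^{G}_\beta(g)=\frac{1}{(g'_x)^2}\,\mathcal Z^{G'}_\beta(g').$$ (2) If the three faces around $x$ are the only internal faces, then these equations for all boundary conditions $\beta$ (the Yang–Baxter equations of the model) hold if and only if $g$ satisfies Kashaev's recurrence at $x$. -/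

import Mathlib

/-- The two colors of loops. -/
inductive LoopColor
  | red
  | blue
  deriving DecidableEq

instance : Fintype LoopColor where
  elems := {.red, .blue}
  complete := fun c => by cases c <;> decide

/-- The indices carried by the edges of a marked loop configuration: red edges carry `0` or `2`,
blue edges carry `A` or `B`. -/
inductive LoopIndex
  | redZero
  | redTwo
  | blueA
  | blueB
  deriving DecidableEq

instance : Fintype LoopIndex where
  elems := {.redZero, .redTwo, .blueA, .blueB}
  complete := fun c => by cases c <;> decide

namespace LoopIndex

def color : LoopIndex → LoopColor
  | redZero => .red
  | redTwo => .red
  | blueA => .blue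
  | blueB => .blue

/-- The other index of the same color. -/
def hat : LoopIndex → LoopIndex
  | redZero => redTwo
  | redTwo => redZero
  | blueA => blueB
  | blueB => blueA

end LoopIndex

/-- The ten local configurations `1_a, 1_b, …, 5_a, 5_b` at a face. The corners of the face are
named `x, u, y, v` in clockwise order and numbered `0, 1, 2, 3`; side `i` joins corner `i` to corner
`i + 1`, so the sides `0, 1, 2, 3` are `xu, uy, yv, vx`. -/
inductive LocalConf
  | oneA
  | oneB
  | twoA
  | twoB
  | threeA
  | threeB
  | fourA
  | fourB
  | fiveA
  | fiveB
  deriving DecidableEq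

instance : Fintype LocalConf where
  elems := {.oneA, .oneB, .twoA, .twoB, .threeA, .threeB, .fourA, .fourB, .fiveA, .fiveB}
  complete := fun c => by cases c <;> decide

namespace LocalConf

/-- `c.partner i` is the side to which side `i` is connected inside the face. -/
def partner : LocalConf → Fin 4 → Fin 4
  | oneA => ![1, 0, 3, 2]
  | oneB => ![1, 0, 3, 2]
  | twoA => ![3, 2, 1, 0]
  | twoB => ![3, 2, 1, 0]
  | threeA => ![1, 0, 3, 2]
  | threeB => ![1, 0, 3, 2]
  | fourA => ![3, 2, 1, 0]
  | fourB => ![3, 2, 1, 0]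
  | fiveA => ![2, 3, 0, 1]
  | fiveB => ![2, 3, 0, 1]

/-- `c.color i` is the color of the path that uses side `i`. -/
def color : LocalConf → Fin 4 → LoopColor
  | oneA => ![.red, .red, .red, .red]
  | oneB => ![.blue, .blue, .blue, .blue]
  | twoA => ![.red, .red, .red, .red]
  | twoB => ![.blue, .blue, .blue, .blue]
  | threeA => ![.red, .red, .blue, .blue]
  | threeB => ![.blue, .blue, .red, .red]
  | fourA => ![.red, .blue, .blue, .red]
  | fourB => ![.blue, .red, .red, .blue]
  | fiveA => ![.red, .blue, .red, .blue]
  | fiveB => ![.blue, .red, .blue, .red]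

/-- Whether two paths (necessarily of different colors) cross inside the face. -/
def IsCrossing (c : LocalConf) : Prop := c = fiveA ∨ c = fiveB

/-- The local weights `w_1, …, w_5` in terms of the variables at the corners `x, u, y, v`. -/
noncomputable def weight (c : LocalConf) (gx gu gy gv : ℝ) : ℝ :=
  match c with
  | oneA => gx * gy
  | oneB => gx * gy
  | twoA => gu * gv
  | twoB => gu * gv
  | threeA => √(gx * gy) * √(gx * gy + gu * gv)
  | threeB => √(gx * gy) * √(gx * gy + gu * gv)
  | fourA => √(gv * gu) * √(gx * gy + gu * gv)
  | fourB => √(gv * gu) * √(gx * gy + gu * gv)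
  | fiveA => √(gx * gy * gu * gv)
  | fiveB => √(gx * gy * gu * gv)

end LocalConf

/-- A simple graph on `V` embedded in an oriented surface, given by a rotation system, with a family
`F` of distinguished (*internal*) faces, all of degree `4`.

`rot v` lists the neighbors of `v` in counterclockwise cyclic order. The face to the right of the
oriented edge from `a` to `b` is walked clockwise, and after `a, b` this walk visits `rot b a`.
For a quadrangulation without boundary, every face is internal; for a planar quadrangulation with
boundary, the internal faces are the bounded ones. -/
structure Quadrangulation (V F : Type*) where
  graph : SimpleGraph V
  rot : V → Equiv.Perm V
  rot_isCycleOn : ∀ v, (rot v).IsCycleOn (graph.neighborSet v)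
  /-- The corners `x, u, y, v` of an internal face, in clockwise order. -/
  corner : F → Fin 4 → V
  adj_corner : ∀ f i, graph.Adj (corner f i) (corner f (i + 1))
  rot_corner : ∀ f i, rot (corner f (i + 1)) (corner f i) = corner f (i + 2)
  /-- Each oriented edge is a side of at most one internal face, and only once. So every internal
  face is listed once, and its boundary walk has length exactly four. -/
  side_injective : Function.Injective
    (fun s : F × Fin 4 => (corner s.1 s.2, corner s.1 (s.2 + 1)))

namespace Quadrangulation

variable {V F : Type*}

/-- The side `i` of the internal face `f`, where `s = (f, i)`, as an oriented edge that has `f`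
on its right. -/
def side (G : Quadrangulation V F) (s : F × Fin 4) : V × V :=
  (G.corner s.1 s.2, G.corner s.1 (s.2 + 1))

/-- Two sides of internal faces are glued if they are the two sides of the same edge of the graph. -/
def Glued (G : Quadrangulation V F) (s t : F × Fin 4) : Prop :=
  G.side t = (G.side s).swap

/-- The side `s` of an internal face is not glued to a side of an internal face: the dual edge
through `s` is an external half-edge. -/
def IsExternal (G : Quadrangulation V F) (s : F × Fin 4) : Prop :=
  ∀ t, ¬ G.Glued s t

/-- A marked loop configuration: `σ f` is the local configuration at the face `f` and `m f i` is the
index of the dual edge through the side `i` of `f`. -/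
structure IsMarkedLoopConf (G : Quadrangulation V F)
    (σ : F → LocalConf) (m : F → Fin 4 → LoopIndex) : Prop where
  /-- Red edges have index `0` or `2`, blue edges have index `A` or `B`. -/
  color_index : ∀ f i, (m f i).color = (σ f).color i
  /-- The index belongs to the edge: the two sides of an edge have the same index, and in particular
  only edges of the same color are glued. -/
  index_glued : ∀ s t, G.Glued s t → m s.1 s.2 = m t.1 t.2
  /-- The index is constant along a path that does not cross another one. -/
  index_turn : ∀ f i, ¬ (σ f).IsCrossing → m f ((σ f).partner i) = m f i
  /-- The index changes when a path of the other color is crossed. -/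
  index_cross : ∀ f i, (σ f).IsCrossing → m f ((σ f).partner i) = (m f i).hat

/-- One step along a path: through a face, or across an edge into the next face. -/
def PathStep (G : Quadrangulation V F) (σ : F → LocalConf) (s t : F × Fin 4) : Prop :=
  t = (s.1, (σ s.1).partner s.2) ∨ G.Glued s t

/-- The two sides are used by the same path. -/
def Connected (G : Quadrangulation V F) (σ : F → LocalConf) (s t : F × Fin 4) : Prop :=
  Relation.ReflTransGen (G.PathStep σ) s t

/-- The indices (hence also the colors) of the paths at the external edges. -/
def boundaryIndices (G : Quadrangulation V F) (m : F → Fin 4 → LoopIndex) :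
    Set ((V × V) × LoopIndex) :=
  {p | ∃ s, G.IsExternal s ∧ p = (G.side s, m s.1 s.2)}

/-- The pairs of external edges that are used by the same path. -/
def boundaryConnections (G : Quadrangulation V F) (σ : F → LocalConf) :
    Set ((V × V) × (V × V)) :=
  {p | ∃ s t, G.IsExternal s ∧ G.IsExternal t ∧ G.Connected σ s t ∧ p = (G.side s, G.side t)}

/-- The weight of a loop configuration, with the local weights parametrized by the variables `g` on
the vertices. There is no factor for the number of loops. -/
noncomputable def markedWeight [Fintype F] (G : Quadrangulation V F) (g : V → ℝ)
    (σ : F → LocalConf) : ℝ :=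
  ∏ f, (σ f).weight (g (G.corner f 0)) (g (G.corner f 1)) (g (G.corner f 2)) (g (G.corner f 3))

end Quadrangulation

/-- A boundary condition: any requirement on the indices (colors) of the external edges and on the
way they are connected by paths. Free boundary conditions are `fun _ _ => True`. Without external
edges both sets are empty, and the condition is void or impossible. -/
abbrev BoundaryCondition (V : Type*) : Type _ :=
  Set ((V × V) × LoopIndex) → Set ((V × V) × (V × V)) → Prop

namespace Quadrangulation

variable {V F : Type*}

open Classical in
/-- The partition function of marked loops with a given boundary condition: the sum of the weights
of all marked loop configurations that satisfy it. -/
noncomputable def markedPartitionFunction [Fintype F] [DecidableEq F] (G : Quadrangulation V F)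
    (B : BoundaryCondition V) (g : V → ℝ) : ℝ :=
  ∑ c ∈ Finset.univ.filter (fun c : (F → LocalConf) × (F → Fin 4 → LoopIndex) =>
      G.IsMarkedLoopConf c.1 c.2 ∧ B (G.boundaryIndices c.2) (G.boundaryConnections c.1)),
    G.markedWeight g c.1

/-- The clockwise cyclic sequence of the corners of `f` is `a, b, c, d`, up to the choice of the
corner that is named first. -/
def HasCorners (G : Quadrangulation V F) (f : F) (a b c d : V) : Prop :=
  ∃ k : Fin 4, ∀ i, G.corner f (i + k) = ![a, b, c, d] i

end Quadrangulation

/-- The vertices `x, v1, …, v23` in the region of a cube flip, and the three faces of this region. -/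
structure CubeLabels (V F : Type*) where
  x : V
  v1 : V
  v2 : V
  v3 : V
  v12 : V
  v13 : V
  v23 : V
  fX : F
  fY : F
  fZ : F

/-- `G'` is obtained from `G` by a cube flip at the vertex `L.x` of degree `3`.

The hexagon around `x` has the corners `v3, v23, v2, v12, v1, v13` in clockwise order. In `G` it
consists of three internal faces and `x` is joined to `v1, v2, v3`; in `G'` it consists of three
other internal faces, for which the three names `fX, fY, fZ` are used again, and `x` is joined to
`v12, v13, v23`. Everything else is the same in `G` and `G'`. -/
structure IsCubeFlip {V F : Type*} (G G' : Quadrangulation V F) (L : CubeLabels V F) : Prop where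
  nodup : [L.x, L.v1, L.v2, L.v3, L.v12, L.v13, L.v23].Nodup
  adj_center : ∀ v, G.graph.Adj L.x v ↔ v = L.v1 ∨ v = L.v2 ∨ v = L.v3
  cornersX : G.HasCorners L.fX L.x L.v3 L.v23 L.v2
  cornersY : G.HasCorners L.fY L.x L.v1 L.v13 L.v3
  cornersZ : G.HasCorners L.fZ L.x L.v2 L.v12 L.v1
  adj_center' : ∀ v, G'.graph.Adj L.x v ↔ v = L.v12 ∨ v = L.v13 ∨ v = L.v23
  cornersX' : G'.HasCorners L.fX L.x L.v12 L.v1 L.v13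
  cornersY' : G'.HasCorners L.fY L.x L.v23 L.v2 L.v12
  cornersZ' : G'.HasCorners L.fZ L.x L.v13 L.v3 L.v23
  adj_other : ∀ a b, a ≠ L.x → b ≠ L.x → (G'.graph.Adj a b ↔ G.graph.Adj a b)
  corner_other : ∀ f, f ≠ L.fX → f ≠ L.fY → f ≠ L.fZ → G'.corner f = G.corner f
  /-- The face walks agree along all oriented edges that do not have one of the three new faces on
  their right. -/
  rot_other : ∀ a b, G'.graph.Adj a b →
    (∀ f i, f = L.fX ∨ f = L.fY ∨ f = L.fZ → G'.side (f, i) ≠ (a, b)) →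
    G'.rot b a = G.rot b a

/-- Kashaev's recurrence: the expression of `g123` in the seven other variables. -/
def KashaevRecurrence (g g1 g2 g3 g12 g13 g23 g123 : ℝ) : Prop :=
  g123 = (2 * g1 * g2 * g3 + g * (g1 * g23 + g2 * g13 + g3 * g12)
    + 2 * √(g * g23 + g2 * g3) * √(g * g13 + g1 * g3) * √(g * g12 + g1 * g2)) / g ^ 2

/-! The two graphs differ only inside the hexagon, and everything outside sees the inside only
through the indices at its six sides and the way these sides are paired by paths. So it suffices
that, for each of the 15 pairings and each choice of six indices, the sum of the inner weights
divided by the square of the central variable is the same before and after the flip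
(`IsStar.markedPartitionFunction_eq`, `hexagonSum_flip`). With the central vertex named first, both
interiors are the same star of three faces, turned by a half-turn and with the roles of the outer
and inner neighbors exchanged.

An index is a color together with a mark, and the two constraints decouple. Marks only record
parities of crossings, which are fixed by the pairing; hence they contribute a factor 0 or 1, or 0
or 2 if there is a loop around the center, consistently on both sides (`markList_cases`). What
remains are equations between sums over colors, fourteen of them up to rotation (`yangBaxterTable`,
`classKinds_table`). After square roots are taken as variables they are polynomial, and they follow
from the recurrence together with its consequence $g_xX'=g_1X+YZ$ and the two rotated relations,
where $X'$, like $X$, is the square root of the sum at the opposite face of the cube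
(`IsKashaevCube.table`).

Conversely, one equation is enough: all sides have index 0, and the two sides of each old face are
paired. After the flip a single configuration remains, so the equation is linear in $g'_x$, and it
is the recurrence multiplied by $g_1g_2g_3$ up to nonzero factors
(`kashaevRecurrence_of_classSum_eq`). -/

/-! ### Independence of the corner that is named first. -/

namespace LocalConf

/-- The same configuration, when the second corner of the face is named first. -/
def rotateOne : LocalConf → LocalConf
  | oneA => twoA
  | oneB => twoB
  | twoA => oneA
  | twoB => oneB
  | threeA => fourA
  | threeB => fourB
  | fourA => threeB
  | fourB => threeA
  | fiveA => fiveB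
  | fiveB => fiveA

/-- The same configuration, when the corner number `k` of the face is named first. -/
def rotate (k : Fin 4) (c : LocalConf) : LocalConf := rotateOne^[k] c

instance : DecidablePred IsCrossing := fun c => inferInstanceAs (Decidable (c = fiveA ∨ c = fiveB))

theorem rotate_neg_rotate : ∀ (k : Fin 4) (c : LocalConf), rotate (-k) (rotate k c) = c := by
  decide

theorem rotate_rotate_neg : ∀ (k : Fin 4) (c : LocalConf), rotate k (rotate (-k) c) = c := by
  decide

theorem partner_rotate : ∀ (k : Fin 4) (c : LocalConf) (i : Fin 4),
    (rotate k c).partner i + k = c.partner (i + k) := by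
  decide

theorem color_rotate : ∀ (k : Fin 4) (c : LocalConf) (i : Fin 4),
    (rotate k c).color i = c.color (i + k) := by
  decide

theorem isCrossing_rotate : ∀ (k : Fin 4) (c : LocalConf),
    (rotate k c).IsCrossing ↔ c.IsCrossing := by
  decide

theorem weight_rotateOne (c : LocalConf) (a b d e : ℝ) :
    (rotateOne c).weight b d e a = c.weight a b d e := by
  cases c <;> simp only [rotateOne, weight] <;> ring_nf

theorem weight_rotate (k : Fin 4) (c : LocalConf) (h : Fin 4 → ℝ) :
    (rotate k c).weight (h (0 + k)) (h (1 + k)) (h (2 + k)) (h (3 + k)) =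
      c.weight (h 0) (h 1) (h 2) (h 3) := by
  fin_cases k
  · rfl
  · exact weight_rotateOne c (h 0) (h 1) (h 2) (h 3)
  · exact (weight_rotateOne _ (h 1) (h 2) (h 3) (h 0)).trans (weight_rotateOne c _ _ _ _)
  · exact (weight_rotateOne _ (h 2) (h 3) (h 0) (h 1)).trans
      ((weight_rotateOne _ (h 1) (h 2) (h 3) (h 0)).trans (weight_rotateOne c _ _ _ _))

end LocalConf

namespace Quadrangulation

variable {V F F₂ : Type*}

/-- The same quadrangulation with internal faces indexed by `F₂`, where the corner that is named
first in the face `f` is the former corner number `k f`. -/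
def relabel (G : Quadrangulation V F) (φ : F₂ ≃ F) (k : F₂ → Fin 4) : Quadrangulation V F₂ where
  graph := G.graph
  rot := G.rot
  rot_isCycleOn := G.rot_isCycleOn
  corner f i := G.corner (φ f) (i + k f)
  adj_corner f i := by
    rw [add_right_comm]; exact G.adj_corner _ _
  rot_corner f i := by
    rw [add_right_comm, add_right_comm i 2]; exact G.rot_corner _ _
  side_injective := by
    rintro ⟨f, i⟩ ⟨f', i'⟩ h
    have h' := @G.side_injective (φ f, i + k f) (φ f', i' + k f')
      (by simpa [add_right_comm] using h)
    obtain ⟨h1, h2⟩ := Prod.mk.inj h'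
    obtain rfl := φ.injective h1
    simpa using h2

/-- The sides of the faces of a relabelled quadrangulation. -/
def relabelSide (φ : F₂ ≃ F) (k : F₂ → Fin 4) : F₂ × Fin 4 ≃ F × Fin 4 where
  toFun s := (φ s.1, s.2 + k s.1)
  invFun s := (φ.symm s.1, s.2 - k (φ.symm s.1))
  left_inv s := by simp
  right_inv s := by simp

/-- The marked configurations of a relabelled quadrangulation. -/
def relabelConf (φ : F₂ ≃ F) (k : F₂ → Fin 4) :
    ((F → LocalConf) × (F → Fin 4 → LoopIndex)) ≃
      ((F₂ → LocalConf) × (F₂ → Fin 4 → LoopIndex)) where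
  toFun c := (fun f => (c.1 (φ f)).rotate (k f), fun f i => c.2 (φ f) (i + k f))
  invFun c := (fun f => (c.1 (φ.symm f)).rotate (-k (φ.symm f)),
    fun f i => c.2 (φ.symm f) (i - k (φ.symm f)))
  left_inv c := by
    ext f
    · simp [LocalConf.rotate_neg_rotate]
    · simp
  right_inv c := by
    ext f
    · simp [LocalConf.rotate_rotate_neg]
    · simp

variable (G : Quadrangulation V F) (φ : F₂ ≃ F) (k : F₂ → Fin 4)

theorem side_relabel (s : F₂ × Fin 4) :
    (G.relabel φ k).side s = G.side (relabelSide φ k s) := by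
  simp [side, relabel, relabelSide, add_right_comm]

theorem glued_relabel (s t : F₂ × Fin 4) :
    (G.relabel φ k).Glued s t ↔ G.Glued (relabelSide φ k s) (relabelSide φ k t) := by
  simp only [Glued, side_relabel]

theorem isExternal_relabel (s : F₂ × Fin 4) :
    (G.relabel φ k).IsExternal s ↔ G.IsExternal (relabelSide φ k s) := by
  simp only [IsExternal, glued_relabel]
  exact (relabelSide φ k).forall_congr_right (q := fun t => ¬ G.Glued (relabelSide φ k s) t)

variable (c : (F → LocalConf) × (F → Fin 4 → LoopIndex))

theorem pathStep_relabel (s t : F₂ × Fin 4) :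
    (G.relabel φ k).PathStep (relabelConf φ k c).1 s t ↔
      G.PathStep c.1 (relabelSide φ k s) (relabelSide φ k t) := by
  simp only [PathStep, glued_relabel]
  refine or_congr_left ?_
  rw [← (relabelSide φ k).apply_eq_iff_eq]
  simp [relabelSide, relabelConf, LocalConf.partner_rotate]

theorem connected_relabel (s t : F₂ × Fin 4) :
    (G.relabel φ k).Connected (relabelConf φ k c).1 s t ↔
      G.Connected c.1 (relabelSide φ k s) (relabelSide φ k t) := by
  constructor
  · exact fun h => h.lift _ fun a b => (G.pathStep_relabel φ k c a b).1
  · intro h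
    have := h.lift (p := (G.relabel φ k).PathStep (relabelConf φ k c).1) (relabelSide φ k).symm
      fun a b hab => (G.pathStep_relabel φ k c _ _).2 (by simpa using hab)
    simpa [Function.onFun, Connected] using this

theorem boundaryIndices_relabel :
    (G.relabel φ k).boundaryIndices (relabelConf φ k c).2 = G.boundaryIndices c.2 := by
  ext p
  simp only [boundaryIndices, Set.mem_ofPred_eq, isExternal_relabel, side_relabel]
  rw [← (relabelSide φ k).exists_congr_right]
  rfl

theorem boundaryConnections_relabel :
    (G.relabel φ k).boundaryConnections (relabelConf φ k c).1 = G.boundaryConnections c.1 := by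
  ext p
  simp only [boundaryConnections, Set.mem_ofPred_eq, isExternal_relabel, side_relabel,
    connected_relabel]
  rw [← (relabelSide φ k).exists_congr_right]
  refine exists_congr fun s => ?_
  rw [← (relabelSide φ k).exists_congr_right]

theorem isMarkedLoopConf_relabel :
    (G.relabel φ k).IsMarkedLoopConf (relabelConf φ k c).1 (relabelConf φ k c).2 ↔
      G.IsMarkedLoopConf c.1 c.2 := by
  have key : ∀ P : F → Fin 4 → Prop, (∀ f i, P (φ f) (i + k f)) ↔ ∀ f i, P f i := by
    refine fun P => ⟨fun h f i => ?_, fun h f i => h _ _⟩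
    simpa using h (φ.symm f) (i - k (φ.symm f))
  constructor
  · rintro ⟨h1, h2, h3, h4⟩
    refine ⟨(key _).1 fun f i => ?_, fun s t h => ?_, (key _).1 fun f i hc => ?_,
      (key _).1 fun f i hc => ?_⟩
    · simpa [relabelConf, LocalConf.color_rotate] using h1 f i
    · have := h2 ((relabelSide φ k).symm s) ((relabelSide φ k).symm t)
        ((G.glued_relabel φ k _ _).2 (by simpa using h))
      simpa [relabelConf, relabelSide] using this
    · simpa [relabelConf, LocalConf.partner_rotate] using
        h3 f i (by simpa [relabelConf, LocalConf.isCrossing_rotate] using hc)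
    · simpa [relabelConf, LocalConf.partner_rotate] using
        h4 f i (by simpa [relabelConf, LocalConf.isCrossing_rotate] using hc)
  · rintro ⟨h1, h2, h3, h4⟩
    refine ⟨fun f i => ?_, fun s t h => ?_, fun f i hc => ?_, fun f i hc => ?_⟩
    · simpa [relabelConf, LocalConf.color_rotate] using h1 _ _
    · exact h2 _ _ ((G.glued_relabel φ k _ _).1 h)
    · simpa [relabelConf, LocalConf.partner_rotate] using
        h3 (φ f) (i + k f) (by simpa [relabelConf, LocalConf.isCrossing_rotate] using hc)
    · simpa [relabelConf, LocalConf.partner_rotate] using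
        h4 (φ f) (i + k f) (by simpa [relabelConf, LocalConf.isCrossing_rotate] using hc)

variable [Fintype F] [Fintype F₂]

theorem markedWeight_relabel (g : V → ℝ) :
    (G.relabel φ k).markedWeight g (relabelConf φ k c).1 = G.markedWeight g c.1 := by
  rw [markedWeight, markedWeight, ← φ.prod_comp]
  exact Finset.prod_congr rfl fun f _ =>
    LocalConf.weight_rotate (k f) (c.1 (φ f)) fun i => g (G.corner (φ f) i)

/-- `HasCorners` fixes corners only up to rotation. This invariance allows the center of the flip to
be corner 0 of its three faces, and the faces to be indexed by `Fin 3 ⊕ F'`. -/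
theorem markedPartitionFunction_relabel [DecidableEq F] [DecidableEq F₂]
    (B : BoundaryCondition V) (g : V → ℝ) :
    (G.relabel φ k).markedPartitionFunction B g = G.markedPartitionFunction B g := by
  classical
  rw [markedPartitionFunction, markedPartitionFunction, Finset.sum_filter, Finset.sum_filter,
    ← (relabelConf φ k).sum_comp]
  refine Finset.sum_congr rfl fun c _ => ?_
  simp only [isMarkedLoopConf_relabel, boundaryIndices_relabel, boundaryConnections_relabel,
    markedWeight_relabel]

end Quadrangulation

/-! ### Separating the hexagon from its exterior. -/

/-- The indices at the four sides of a face are possible for the local configuration. -/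
def LocalConf.IsMarked (c : LocalConf) (m : Fin 4 → LoopIndex) : Prop :=
  (∀ i, (m i).color = c.color i) ∧ (∀ i, ¬ c.IsCrossing → m (c.partner i) = m i) ∧
    ∀ i, c.IsCrossing → m (c.partner i) = (m i).hat

/-- The sides of the hexagon formed by three faces around a vertex: `(j, 0)` and `(j, 1)` are the
sides `1` and `2` of the face `j`, whose first corner is the central vertex. -/
abbrev HexSide : Type := Fin 3 × Fin 2

/-- A side of the hexagon as a side of one of the three faces. -/
def HexSide.toSide (e : HexSide) : Fin 3 × Fin 4 := (e.1, ![1, 2] e.2)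

/-- Marked configurations on three faces around a vertex, where the side `0` of the face `j` is
glued to the side `3` of the face `j + 1`. -/
def IsMarkedStar (t : Fin 3 → LocalConf) (m : Fin 3 → Fin 4 → LoopIndex) : Prop :=
  (∀ j, (t j).IsMarked (m j)) ∧ ∀ j, m j 0 = m (j + 1) 3

/-- One step along a path inside three faces around a vertex; `p j` maps each side of the face `j`
to the side to which it is connected. -/
def StarStep (p : Fin 3 → Fin 4 → Fin 4) (s t : Fin 3 × Fin 4) : Prop :=
  t = (s.1, p s.1 s.2) ∨ (s.2 = 0 ∧ t = (s.1 + 1, 3)) ∨ (s.2 = 3 ∧ t = (s.1 + 2, 0))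

/-- Two sides of the hexagon are connected inside it. -/
def HexConnected (p : Fin 3 → Fin 4 → Fin 4) (e e' : HexSide) : Prop :=
  Relation.ReflTransGen (StarStep p) e.toSide e'.toSide

section Outer

variable {V F' : Type*}

/-- The sides of the internal faces other than the three faces of the hexagon, together with the
sides of the hexagon. -/
abbrev OuterSide (F' : Type*) : Type _ := HexSide ⊕ F' × Fin 4

variable (sd : OuterSide F' → V × V) (σ : F' → LocalConf) (n : F' → Fin 4 → LoopIndex)
  (b : HexSide → LoopIndex) (M : HexSide → HexSide → Prop)

/-- The index at an outer side. -/
def outerIndex : OuterSide F' → LoopIndex := Sum.elim b fun s => n s.1 s.2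

/-- The configuration outside the hexagon is marked, and fits to the indices on the hexagon. -/
def IsMarkedOuter : Prop :=
  (∀ f, (σ f).IsMarked (n f)) ∧
    ∀ s t, sd t = (sd s).swap → outerIndex n b s = outerIndex n b t

/-- The boundary indices, in terms of the outer configuration. -/
def outerBoundaryIndices : Set ((V × V) × LoopIndex) :=
  {p | ∃ s, (∀ t, sd t ≠ (sd s).swap) ∧ p = (sd s, outerIndex n b s)}

/-- One step along a path, where the hexagon is crossed in one step according to `M`. -/
def OuterStep (s t : OuterSide F') : Prop :=
  (∃ f i, s = .inr (f, i) ∧ t = .inr (f, (σ f).partner i)) ∨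
    (∃ e e', s = .inl e ∧ t = .inl e' ∧ M e e') ∨ sd t = (sd s).swap

/-- The boundary connections, in terms of the outer configuration and of the connections inside the
hexagon. -/
def outerBoundaryConnections : Set ((V × V) × (V × V)) :=
  {p | ∃ s t, (∀ u, sd u ≠ (sd s).swap) ∧ (∀ u, sd u ≠ (sd t).swap) ∧
    Relation.ReflTransGen (OuterStep sd σ M) s t ∧ p = (sd s, sd t)}

/-- The indices and connections at the hexagon fit to the outer configuration and to the boundary
condition. -/
def OuterCondition (B : BoundaryCondition V) : Prop :=
  IsMarkedOuter sd σ n b ∧ B (outerBoundaryIndices sd n b) (outerBoundaryConnections sd σ M)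

end Outer

namespace Quadrangulation

variable {V F F' : Type*}

theorem isMarkedLoopConf_iff (G : Quadrangulation V F) (σ : F → LocalConf)
    (m : F → Fin 4 → LoopIndex) :
    G.IsMarkedLoopConf σ m ↔ (∀ f, (σ f).IsMarked (m f)) ∧
      ∀ s t, G.Glued s t → m s.1 s.2 = m t.1 t.2 :=
  ⟨fun h => ⟨fun f => ⟨h.1 f, h.3 f, h.4 f⟩, h.2⟩,
    fun h => ⟨fun f => (h.1 f).1, h.2, fun f => (h.1 f).2.1, fun f => (h.1 f).2.2⟩⟩

theorem Glued.symm {G : Quadrangulation V F} {s t : F × Fin 4} (h : G.Glued s t) : G.Glued t s := by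
  rw [Glued] at *; rw [h, Prod.swap_swap]

theorem Glued.unique {G : Quadrangulation V F} {s t u : F × Fin 4} (h : G.Glued s t)
    (h' : G.Glued s u) : t = u :=
  G.side_injective (show G.side t = G.side u from Eq.trans h (Eq.symm h'))

/-- The first three faces are arranged around a vertex of degree three. -/
def IsStar (G : Quadrangulation V (Fin 3 ⊕ F')) : Prop :=
  ∃ x, ∀ j, G.corner (.inl j) 0 = x ∧ G.corner (.inl j) 1 = G.corner (.inl (j + 1)) 3

/-- An outer side as a side of an internal face, with the sides of the hexagon permuted by `θ`. -/
def outerSide (θ : HexSide → HexSide) : OuterSide F' → (Fin 3 ⊕ F') × Fin 4 :=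
  Sum.elim (fun e => (.inl (θ e).toSide.1, (θ e).toSide.2)) fun s => (.inr s.1, s.2)

variable {G : Quadrangulation V (Fin 3 ⊕ F')} (hG : G.IsStar) (θ : Equiv.Perm HexSide)

theorem outerSide_injective : Function.Injective (outerSide (F' := F') θ) := by
  have h2 : ∀ e e' : HexSide, e.toSide = e'.toSide → e = e' := by
    simp only [HexSide, HexSide.toSide, Prod.forall]; decide
  rintro (e | s) (e' | s') h
  · simp only [outerSide, Sum.elim_inl, Prod.mk.injEq, Sum.inl.injEq] at h
    exact congrArg _ (θ.injective (h2 _ _ (Prod.ext h.1 h.2)))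
  · simp [outerSide] at h
  · simp [outerSide] at h
  · simp only [outerSide, Sum.elim_inr, Prod.mk.injEq, Sum.inr.injEq] at h
    exact congrArg _ (Prod.ext h.1 h.2)

theorem outerSide_cases (s : (Fin 3 ⊕ F') × Fin 4) :
    (∃ u, s = outerSide θ u) ∨ (∃ j, s = (.inl j, 0)) ∨ ∃ j, s = (.inl j, 3) := by
  have key : ∀ i : Fin 4, i = 0 ∨ i = 3 ∨ ∃ k : Fin 2, i = ![1, 2] k := by decide
  rcases s with ⟨j | f, i⟩
  · rcases key i with rfl | rfl | ⟨k, rfl⟩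
    · exact .inr (.inl ⟨j, rfl⟩)
    · exact .inr (.inr ⟨j, rfl⟩)
    · exact .inl ⟨.inl (θ.symm (j, k)), by simp [outerSide, HexSide.toSide]⟩
  · exact .inl ⟨.inr (f, i), rfl⟩

theorem outerSide_ne_zero (u : OuterSide F') (j : Fin 3) : outerSide θ u ≠ (.inl j, 0) := by
  have key : ∀ k : Fin 2, (![1, 2] k : Fin 4) ≠ 0 := by decide
  rcases u with e | s <;> simp [outerSide, HexSide.toSide, key]

theorem outerSide_ne_three (u : OuterSide F') (j : Fin 3) : outerSide θ u ≠ (.inl j, 3) := by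
  have key : ∀ k : Fin 2, (![1, 2] k : Fin 4) ≠ 3 := by decide
  rcases u with e | s <;> simp [outerSide, HexSide.toSide, key]

include hG

theorem IsStar.glued_zero (j : Fin 3) : G.Glued (.inl j, 0) (.inl (j + 1), 3) := by
  obtain ⟨x, hx⟩ := hG
  have h := hx (j + 1)
  have h' := hx j
  simp only [Glued, side, Prod.swap_prod_mk, zero_add]
  rw [h.1.symm.trans rfl] at h'
  exact Prod.ext h'.2.symm h'.1.symm

theorem IsStar.glued_three (j : Fin 3) : G.Glued (.inl j, 3) (.inl (j + 2), 0) := by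
  have h := (hG.glued_zero (j + 2)).symm
  rwa [show j + 2 + 1 = j by fin_cases j <;> rfl] at h

/-- A side has at most one partner under gluing, and the sides 0 and 3 of the star are already glued
to each other; so nothing from outside can be glued to them. -/
theorem IsStar.glued_outerSide {u : OuterSide F'} {t : (Fin 3 ⊕ F') × Fin 4}
    (h : G.Glued (outerSide θ u) t) : ∃ v, t = outerSide θ v := by
  rcases outerSide_cases θ t with h' | ⟨j, rfl⟩ | ⟨j, rfl⟩
  · exact h'
  · exact absurd (h.symm.unique (hG.glued_zero j)) (outerSide_ne_three θ u _)
  · exact absurd (h.symm.unique (hG.glued_three j)) (outerSide_ne_zero θ u _)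

theorem IsStar.isExternal_iff (s : (Fin 3 ⊕ F') × Fin 4) :
    G.IsExternal s ↔ ∃ u, s = outerSide θ u ∧ ∀ v, ¬ G.Glued (outerSide θ u) (outerSide θ v) := by
  constructor
  · intro h
    rcases outerSide_cases θ s with ⟨u, rfl⟩ | ⟨j, rfl⟩ | ⟨j, rfl⟩
    · exact ⟨u, rfl, fun v => h _⟩
    · exact absurd (hG.glued_zero j) (h _)
    · exact absurd (hG.glued_three j) (h _)
  · rintro ⟨u, rfl, h⟩ t ht
    obtain ⟨v, rfl⟩ := hG.glued_outerSide θ ht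
    exact h v ht

variable {sd : OuterSide F' → V × V} (hsd : ∀ s, sd s = G.side (outerSide θ s))
  (t : Fin 3 → LocalConf) (m : Fin 3 → Fin 4 → LoopIndex)
  (σ : F' → LocalConf) (n : F' → Fin 4 → LoopIndex)

omit hG in
theorem elim_outerSide (u : OuterSide F') :
    (Sum.elim m n (outerSide θ u).1 (outerSide θ u).2 : LoopIndex) =
      outerIndex n (fun e => m (θ e).toSide.1 (θ e).toSide.2) u := by
  rcases u with e | s <;> rfl

include hsd

omit hG in
theorem glued_outerSide_iff (u v : OuterSide F') :
    G.Glued (outerSide θ u) (outerSide θ v) ↔ sd v = (sd u).swap := by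
  rw [hsd, hsd, Glued]

theorem IsStar.isMarkedLoopConf_iff :
    G.IsMarkedLoopConf (Sum.elim t σ) (Sum.elim m n) ↔
      IsMarkedStar t m ∧
        IsMarkedOuter sd σ n fun e => m (θ e).toSide.1 (θ e).toSide.2 := by
  rw [Quadrangulation.isMarkedLoopConf_iff, Sum.forall, IsMarkedStar, IsMarkedOuter]
  simp only [Sum.elim_inl, Sum.elim_inr]
  constructor
  · rintro ⟨⟨h1, h2⟩, h3⟩
    refine ⟨⟨h1, fun j => h3 _ _ (hG.glued_zero j)⟩, h2, fun u v h => ?_⟩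
    have := h3 _ _ ((glued_outerSide_iff θ hsd u v).2 h)
    rwa [elim_outerSide, elim_outerSide] at this
  · rintro ⟨⟨h1, h3⟩, h2, h4⟩
    refine ⟨⟨h1, h2⟩, fun u v h => ?_⟩
    rcases outerSide_cases θ u with ⟨u, rfl⟩ | ⟨j, rfl⟩ | ⟨j, rfl⟩
    · obtain ⟨v, rfl⟩ := hG.glued_outerSide θ h
      rw [elim_outerSide, elim_outerSide]
      exact h4 _ _ ((glued_outerSide_iff θ hsd u v).1 h)
    · obtain rfl := (hG.glued_zero j).unique h
      exact h3 j
    · obtain rfl := (hG.glued_three j).unique h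
      have := h3 (j + 2)
      rw [show j + 2 + 1 = j by fin_cases j <;> rfl] at this
      exact this.symm

theorem IsStar.boundaryIndices_eq :
    G.boundaryIndices (Sum.elim m n) =
      outerBoundaryIndices sd n fun e => m (θ e).toSide.1 (θ e).toSide.2 := by
  ext p
  simp only [boundaryIndices, outerBoundaryIndices, Set.mem_ofPred_eq, hG.isExternal_iff θ,
    glued_outerSide_iff θ hsd]
  constructor
  · rintro ⟨s, ⟨u, rfl, h⟩, rfl⟩
    exact ⟨u, h, by rw [elim_outerSide, hsd]⟩
  · rintro ⟨u, h, rfl⟩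
    exact ⟨_, ⟨u, rfl, h⟩, by rw [elim_outerSide, hsd]⟩

/-- A path alternates between steps outside and excursions through the hexagon, and each excursion
from one hexagon side to another is contracted to a single step. -/
theorem IsStar.connected_iff (u v : OuterSide F') :
    G.Connected (Sum.elim t σ) (outerSide θ u) (outerSide θ v) ↔
      Relation.ReflTransGen (OuterStep sd σ fun e e' =>
        HexConnected (fun j => (t j).partner) (θ e) (θ e')) u v := by
  set M : HexSide → HexSide → Prop :=
    fun e e' => HexConnected (fun j => (t j).partner) (θ e) (θ e')
  constructor
  · intro h
    -- Invariant along the path: either it is at a side of another face, or it is inside the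
    -- hexagon, and then the last hexagon side `e` through which it entered is remembered.
    have key : ∀ y, G.Connected (Sum.elim t σ) (outerSide θ u) y →
        (∃ s, y = (.inr s.1, s.2) ∧
          Relation.ReflTransGen (OuterStep sd σ M) u (.inr s)) ∨
        ∃ (s : Fin 3 × Fin 4) (e : HexSide), y = (.inl s.1, s.2) ∧
          Relation.ReflTransGen (OuterStep sd σ M) u (.inl e) ∧
          Relation.ReflTransGen (StarStep fun j => (t j).partner) (θ e).toSide s := by
      have reached : ∀ v, Relation.ReflTransGen (OuterStep sd σ M) u v →
          (∃ s, outerSide θ v = (.inr s.1, s.2) ∧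
            Relation.ReflTransGen (OuterStep sd σ M) u (.inr s)) ∨
          ∃ (s : Fin 3 × Fin 4) (e : HexSide), outerSide θ v = (.inl s.1, s.2) ∧
            Relation.ReflTransGen (OuterStep sd σ M) u (.inl e) ∧
            Relation.ReflTransGen (StarStep fun j => (t j).partner) (θ e).toSide s := by
        rintro (e | s) hv
        · exact .inr ⟨(θ e).toSide, e, rfl, hv, .refl⟩
        · exact .inl ⟨s, rfl, hv⟩
      intro y hy
      induction hy with
      | refl => exact reached u .refl
      | tail _ hstep ih =>
        rcases ih with ⟨⟨f, i⟩, rfl, hs⟩ | ⟨⟨j, i⟩, e, rfl, hs, hc⟩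
        · rcases hstep with rfl | hstep
          · exact .inl ⟨(f, (σ f).partner i), rfl, hs.tail (.inl ⟨f, i, rfl, rfl⟩)⟩
          · obtain ⟨w, rfl⟩ := hG.glued_outerSide θ (u := .inr (f, i)) hstep
            exact reached w (hs.tail (.inr (.inr
              ((glued_outerSide_iff θ hsd (.inr (f, i)) w).1 hstep))))
        · rcases hstep with rfl | hstep
          · exact .inr ⟨(j, (t j).partner i), e, rfl, hs, hc.tail (.inl rfl)⟩
          · rcases outerSide_cases θ (.inl j, i) with ⟨w, hw⟩ | ⟨j', h⟩ | ⟨j', h⟩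
            · rcases w with e' | w
              · rw [hw] at hstep
                obtain ⟨z, rfl⟩ := hG.glued_outerSide θ hstep
                have hij : (j, i) = (θ e').toSide := by
                  simpa [outerSide, Prod.ext_iff] using hw
                rw [hij] at hc
                exact reached z ((hs.tail (.inr (.inl ⟨e, e', rfl, rfl, hc⟩))).tail
                  (.inr (.inr ((glued_outerSide_iff θ hsd _ z).1 hstep))))
              · simp [outerSide] at hw
            · obtain ⟨h1, rfl⟩ := Prod.mk.inj h
              obtain rfl := (hG.glued_zero j).unique hstep
              exact .inr ⟨(j + 1, 3), e, rfl, hs, hc.tail (.inr (.inl ⟨rfl, rfl⟩))⟩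
            · obtain ⟨h1, rfl⟩ := Prod.mk.inj h
              obtain rfl := (hG.glued_three j).unique hstep
              exact .inr ⟨(j + 2, 0), e, rfl, hs, hc.tail (.inr (.inr ⟨rfl, rfl⟩))⟩
    rcases key _ h with ⟨s, hy, hs⟩ | ⟨s, e, hy, hs, hc⟩
    · rwa [outerSide_injective θ (a₁ := v) (a₂ := .inr s) hy]
    · rcases v with e' | v
      · have hij : s = (θ e').toSide := by
          simpa [outerSide, Prod.ext_iff, eq_comm] using hy
        rw [hij] at hc
        exact hs.tail (.inr (.inl ⟨e, e', rfl, rfl, hc⟩))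
      · simp [outerSide] at hy
  · intro h
    have lift : ∀ s s', Relation.ReflTransGen (StarStep fun j => (t j).partner) s s' →
        G.Connected (Sum.elim t σ) (.inl s.1, s.2) (.inl s'.1, s'.2) := by
      refine fun s s' hs => hs.lift (fun s : Fin 3 × Fin 4 => ((.inl s.1 : Fin 3 ⊕ F'), s.2)) ?_
      rintro ⟨j, i⟩ s' (rfl | ⟨hi, rfl⟩ | ⟨hi, rfl⟩)
      · exact .inl rfl
      · obtain rfl : i = 0 := hi
        exact .inr (hG.glued_zero j)
      · obtain rfl : i = 3 := hi
        exact .inr (hG.glued_three j)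
    induction h with
    | refl => exact .refl
    | @tail w z _ hstep ih =>
      refine Relation.ReflTransGen.trans ih ?_
      rcases hstep with ⟨f, i, rfl, rfl⟩ | ⟨e, e', rfl, rfl, hM⟩ | hstep
      · exact .single (.inl rfl)
      · exact lift _ _ hM
      · exact .single (.inr ((glued_outerSide_iff θ hsd w z).2 hstep))

theorem IsStar.boundaryConnections_eq :
    G.boundaryConnections (Sum.elim t σ) =
      outerBoundaryConnections sd σ fun e e' =>
        HexConnected (fun j => (t j).partner) (θ e) (θ e') := by
  ext p
  simp only [boundaryConnections, outerBoundaryConnections, Set.mem_ofPred_eq,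
    hG.isExternal_iff θ, glued_outerSide_iff θ hsd]
  constructor
  · rintro ⟨_, _, ⟨u, rfl, hu⟩, ⟨v, rfl, hv⟩, hc, rfl⟩
    exact ⟨u, v, hu, hv, (hG.connected_iff θ hsd t σ u v).1 hc, by rw [hsd, hsd]⟩
  · rintro ⟨u, v, hu, hv, hc, rfl⟩
    exact ⟨_, _, ⟨u, rfl, hu⟩, ⟨v, rfl, hv⟩, (hG.connected_iff θ hsd t σ u v).2 hc,
      by rw [hsd, hsd]⟩

end Quadrangulation

open Classical in
/-- The sum of the weights of the marked configurations on the three faces of a hexagon, where the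
indices on the sides of the hexagon and their connections have the property `P`. -/
noncomputable def hexagonSum (w : Fin 3 → LocalConf → ℝ)
    (P : (HexSide → LoopIndex) → (HexSide → HexSide → Prop) → Prop) : ℝ :=
  ∑ c : (Fin 3 → LocalConf) × (Fin 3 → Fin 4 → LoopIndex),
    if IsMarkedStar c.1 c.2 ∧ P (fun e => c.2 e.toSide.1 e.toSide.2)
      (HexConnected fun j => (c.1 j).partner) then ∏ j, w j (c.1 j) else 0

namespace Quadrangulation

variable {V F' : Type*} [Fintype F'] [DecidableEq F']

/-- The weights of the local configurations at the face `f`. -/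
noncomputable def faceWeight {F : Type*} (G : Quadrangulation V F) (g : V → ℝ) (f : F)
    (c : LocalConf) : ℝ :=
  c.weight (g (G.corner f 0)) (g (G.corner f 1)) (g (G.corner f 2)) (g (G.corner f 3))

/-- The permutation `θ` lets both graphs use the same map `sd`: with the identity before the flip
and `hexFlip` after it, the outer sum has literally the same index set and the same condition. -/
theorem IsStar.markedPartitionFunction_eq {G : Quadrangulation V (Fin 3 ⊕ F')} (hG : G.IsStar)
    (θ : Equiv.Perm HexSide) {sd : OuterSide F' → V × V}
    (hsd : ∀ s, sd s = G.side (outerSide θ s)) (B : BoundaryCondition V) (g : V → ℝ) :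
    G.markedPartitionFunction B g =
      ∑ o : (F' → LocalConf) × (F' → Fin 4 → LoopIndex),
        (∏ f, G.faceWeight g (.inr f) (o.1 f)) *
          hexagonSum (fun j => G.faceWeight g (.inl j)) fun b M =>
            OuterCondition sd o.1 o.2 (b ∘ θ) (fun e e' => M (θ e) (θ e')) B := by
  classical
  let ε : ((Fin 3 → LocalConf) × (Fin 3 → Fin 4 → LoopIndex)) ×
      ((F' → LocalConf) × (F' → Fin 4 → LoopIndex)) ≃
      ((Fin 3 ⊕ F' → LocalConf) × (Fin 3 ⊕ F' → Fin 4 → LoopIndex)) :=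
    (Equiv.prodProdProdComm _ _ _ _).trans (Equiv.prodCongr
      (Equiv.sumArrowEquivProdArrow _ _ _).symm (Equiv.sumArrowEquivProdArrow _ _ _).symm)
  rw [markedPartitionFunction, Finset.sum_filter, ← ε.sum_comp, Fintype.sum_prod_type_right]
  refine Finset.sum_congr rfl fun o _ => ?_
  rw [hexagonSum, Finset.mul_sum]
  refine Finset.sum_congr rfl fun l _ => ?_
  obtain ⟨t, m⟩ := l
  obtain ⟨σ, n⟩ := o
  change (if G.IsMarkedLoopConf (Sum.elim t σ) (Sum.elim m n) ∧
    B (G.boundaryIndices (Sum.elim m n)) (G.boundaryConnections (Sum.elim t σ)) then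
      G.markedWeight g (Sum.elim t σ) else 0) = _
  rw [mul_ite, mul_zero]
  refine if_congr ?_ ?_ rfl
  · rw [hG.isMarkedLoopConf_iff θ hsd, hG.boundaryIndices_eq θ hsd,
      hG.boundaryConnections_eq θ hsd]
    exact and_assoc
  rw [markedWeight, Fintype.prod_sum_type, mul_comm]
  rfl

end Quadrangulation

/-! ### Shapes, and the decoupling of colors and marks. -/

/-- The three ways to connect the sides of a face in pairs. -/
inductive Shape
  | one
  | two
  | cross
  deriving DecidableEq

instance : Fintype Shape where
  elems := {.one, .two, .cross}
  complete := fun p => by cases p <;> decide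

namespace Shape

/-- The side to which a side is connected. -/
def partner : Shape → Fin 4 → Fin 4
  | one => ![1, 0, 3, 2]
  | two => ![3, 2, 1, 0]
  | cross => ![2, 3, 0, 1]

/-- The type (`0, …, 4` for `1, …, 5`) of a local configuration with given colors at the four
sides, if there is one. -/
def kind : Shape → Bool → Bool → Bool → Bool → Option (Fin 5)
  | one, a, b, c, d => bif a == b && c == d then some (bif a == c then 0 else 2) else none
  | two, a, b, c, d => bif a == d && b == c then some (bif a == b then 1 else 3) else none
  | cross, a, b, c, d => bif a == c && b == d && (a != b) then some 4 else none

/-- Whether the indices at the four sides are possible; `true` and `false` are the two indices of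
each color. -/
def marksOk : Shape → Bool → Bool → Bool → Bool → Bool
  | one, a, b, c, d => a == b && c == d
  | two, a, b, c, d => a == d && b == c
  | cross, a, b, c, d => (a != c) && (b != d)

/-- The local configuration with given colors at the four sides. -/
def conf : Shape → Bool → Bool → Bool → Bool → LocalConf
  | one, a, _, c, _ => bif a then (bif c then .oneB else .threeB) else (bif c then .threeA else .oneA)
  | two, a, b, _, _ => bif a then (bif b then .twoB else .fourB) else (bif b then .fourA else .twoA)
  | cross, a, _, _, _ => bif a then .fiveB else .fiveA

end Shape

namespace LocalConf

/-- The way in which the sides are connected. -/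
def shape : LocalConf → Shape
  | oneA => .one
  | oneB => .one
  | threeA => .one
  | threeB => .one
  | twoA => .two
  | twoB => .two
  | fourA => .two
  | fourB => .two
  | fiveA => .cross
  | fiveB => .cross

/-- The type of a local configuration, where `0, …, 4` stand for `1, …, 5`. -/
def kind : LocalConf → Fin 5
  | oneA => 0
  | oneB => 0
  | twoA => 1
  | twoB => 1
  | threeA => 2
  | threeB => 2
  | fourA => 3
  | fourB => 3
  | fiveA => 4
  | fiveB => 4

theorem partner_eq_shape (c : LocalConf) : c.partner = c.shape.partner := by
  cases c <;> rfl

end LocalConf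

namespace LoopIndex

/-- The color and the index as Boolean values. -/
def bits : LoopIndex ≃ Bool × Bool where
  toFun
    | redZero => (false, false)
    | redTwo => (false, true)
    | blueA => (true, false)
    | blueB => (true, true)
  invFun
    | (false, false) => redZero
    | (false, true) => redTwo
    | (true, false) => blueA
    | (true, true) => blueB
  left_inv := by rintro (_ | _ | _ | _) <;> rfl
  right_inv := by rintro ⟨_ | _, _ | _⟩ <;> rfl

abbrev col (i : LoopIndex) : Bool := (bits i).1

abbrev mark (i : LoopIndex) : Bool := (bits i).2

end LoopIndex

open LoopIndex

theorem LocalConf.IsMarked.eq_conf {c : LocalConf} {i₀ i₁ i₂ i₃ : LoopIndex}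
    (h : c.IsMarked ![i₀, i₁, i₂, i₃]) :
    c.shape.kind i₀.col i₁.col i₂.col i₃.col = some c.kind ∧
      c.shape.marksOk i₀.mark i₁.mark i₂.mark i₃.mark = true ∧
      c.shape.conf i₀.col i₁.col i₂.col i₃.col = c := by
  revert c i₀ i₁ i₂ i₃
  simp only [LocalConf.IsMarked]
  decide +kernel

theorem Shape.isMarked_conf {p : Shape} {i₀ i₁ i₂ i₃ : LoopIndex} {τ : Fin 5}
    (h : p.kind i₀.col i₁.col i₂.col i₃.col = some τ)
    (h' : p.marksOk i₀.mark i₁.mark i₂.mark i₃.mark = true) :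
    (p.conf i₀.col i₁.col i₂.col i₃.col).IsMarked ![i₀, i₁, i₂, i₃] ∧
      (p.conf i₀.col i₁.col i₂.col i₃.col).shape = p := by
  revert p i₀ i₁ i₂ i₃ τ
  simp only [LocalConf.IsMarked]
  decide +kernel

/-- The weight of a configuration of given type, if there is one. -/
def kindWeight (ω : Fin 5 → ℝ) (o : Option (Fin 5)) : ℝ := o.elim 0 ω

/-- The sum of the weights over the colors of the three edges at the center, when the shapes and the
colors at the hexagon are given. -/
def colorSum (ω : Fin 3 → Fin 5 → ℝ) (p : Fin 3 → Shape) (c : HexSide → Bool) : ℝ :=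
  ∑ a : Fin 3 → Bool,
    ∏ j, kindWeight (ω j) ((p j).kind (a j) (c (j, 0)) (c (j, 1)) (a (j + 2)))

/-- The number of ways to mark the three edges at the center. -/
def markCount (p : Fin 3 → Shape) (β : HexSide → Bool) : ℕ :=
  ∑ a : Fin 3 → Bool,
    if ∀ j, (p j).marksOk (a j) (β (j, 0)) (β (j, 1)) (a (j + 2)) = true then 1 else 0

/-- The indices on all sides of the three faces. -/
def starIndices (b : HexSide → LoopIndex) (a : Fin 3 → LoopIndex) (j : Fin 3) : Fin 4 → LoopIndex :=
  ![a j, b (j, 0), b (j, 1), a (j + 2)]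

theorem IsMarkedStar.eq_starIndices {t : Fin 3 → LocalConf} {m : Fin 3 → Fin 4 → LoopIndex}
    (h : IsMarkedStar t m) :
    m = starIndices (fun e => m e.toSide.1 e.toSide.2) fun j => m j 0 := by
  funext j i
  fin_cases i
  · rfl
  · rfl
  · rfl
  · have := h.2 (j + 2)
    rw [show j + 2 + 1 = j by fin_cases j <;> rfl] at this
    exact this.symm

-- A marked star is determined by its shapes, the six outer indices and the three central ones. The
-- colors alone decide which local configurations exist and what they weigh, the marks alone obey
-- the crossing rule, so the sum over central indices is a product of two sums.
set_option linter.constructorNameAsVariable false in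
open Classical in
theorem hexagonSum_eq_sum_shape (ω : Fin 3 → Fin 5 → ℝ)
    (P : (HexSide → LoopIndex) → (HexSide → HexSide → Prop) → Prop) :
    hexagonSum (fun j c => ω j c.kind) P =
      ∑ p : Fin 3 → Shape, ∑ b : HexSide → LoopIndex,
        if P b (HexConnected fun j => (p j).partner) then
          markCount p (fun e => (b e).mark) * colorSum ω p (fun e => (b e).col) else 0 := by
  have step : hexagonSum (fun j c => ω j c.kind) P =
      ∑ d : (Fin 3 → Shape) × (HexSide → LoopIndex) × (Fin 3 → LoopIndex),
        if P d.2.1 (HexConnected fun j => (d.1 j).partner) then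
          (if ∀ j, (d.1 j).marksOk (d.2.2 j).mark (d.2.1 (j, 0)).mark (d.2.1 (j, 1)).mark
            (d.2.2 (j + 2)).mark = true then 1 else 0) *
          ∏ j, kindWeight (ω j) ((d.1 j).kind (d.2.2 j).col (d.2.1 (j, 0)).col (d.2.1 (j, 1)).col
            (d.2.2 (j + 2)).col) else 0 := by
    rw [hexagonSum]
    simp only [ite_and]
    rw [← Finset.sum_filter]
    refine Finset.sum_of_injOn
      (fun c => (fun j => (c.1 j).shape, (fun e => c.2 e.toSide.1 e.toSide.2), fun j => c.2 j 0))
      ?_ (by rw [Finset.coe_univ]; exact Set.mapsTo_univ _ _) ?_ ?_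
    · rintro ⟨t, m⟩ h ⟨t', m'⟩ h' heq
      simp only [Finset.coe_filter, Finset.mem_univ, true_and, Set.mem_ofPred_eq] at h h'
      simp only [Prod.mk.injEq] at heq
      have hm : m = m' := by
        rw [h.eq_starIndices, h'.eq_starIndices, heq.2.1, heq.2.2]
      subst hm
      refine Prod.ext (funext fun j => ?_) rfl
      have h1 := h.1 j
      have h2 := h'.1 j
      rw [h.eq_starIndices] at h1 h2
      change t j = t' j
      rw [← h1.eq_conf.2.2, ← h2.eq_conf.2.2, congrFun heq.1 j]
    · rintro ⟨p, b, a⟩ - hd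
      simp only [ite_mul, one_mul, zero_mul]
      rw [← ite_and, ite_eq_right_iff]
      rintro ⟨-, hok⟩
      by_contra hne
      -- A triple of shapes and indices with a nonzero term comes from a configuration: a shape
      -- incompatible with the colors would contribute a factor 0.
      have hτ : ∀ j, ∃ τ, (p j).kind (a j).col (b (j, 0)).col (b (j, 1)).col (a (j + 2)).col =
          some τ := by
        intro j
        by_contra hj
        refine hne (Finset.prod_eq_zero (Finset.mem_univ j) ?_)
        rw [Option.eq_none_iff_forall_ne_some.2 fun τ h => hj ⟨τ, h⟩]
        rfl
      have hconf := fun j => Shape.isMarked_conf (hτ j).choose_spec (hok j)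
      refine hd ⟨(fun j => (p j).conf (a j).col (b (j, 0)).col (b (j, 1)).col (a (j + 2)).col,
        starIndices b a), ?_, ?_⟩
      · simp only [Finset.coe_filter, Finset.mem_univ, true_and, Set.mem_ofPred_eq]
        refine ⟨fun j => (hconf j).1, fun j => ?_⟩
        fin_cases j <;> rfl
      · refine Prod.ext (funext fun j => (hconf j).2) (Prod.ext (funext fun e => ?_) rfl)
        obtain ⟨j, k⟩ := e
        fin_cases k <;> rfl
    · rintro ⟨t, m⟩ h
      simp only [Finset.mem_filter, Finset.mem_univ, true_and] at h
      simp only [LocalConf.partner_eq_shape]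
      refine if_congr Iff.rfl ?_ rfl
      have hm : ∀ j, (t j).IsMarked ![m j 0, m j 1, m j 2, m (j + 2) 0] := by
        intro j
        have h1 := h.1 j
        rw [h.eq_starIndices] at h1
        exact h1
      refine Eq.symm ((congrArg (· * _) (if_pos fun j => (hm j).eq_conf.2.1)).trans ?_)
      refine (one_mul _).trans (Finset.prod_congr rfl fun j _ => ?_)
      exact congrArg (kindWeight (ω j)) (hm j).eq_conf.1
  rw [step, Fintype.sum_prod_type]
  refine Finset.sum_congr rfl fun p _ => ?_
  rw [Fintype.sum_prod_type]
  refine Finset.sum_congr rfl fun b _ => ?_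
  by_cases hP : P b (HexConnected fun j => (p j).partner)
  · simp only [if_pos hP]
    -- The three central indices are split into three colors and three marks.
    rw [markCount, colorSum, Nat.cast_sum, mul_comm, Finset.sum_mul_sum, ← Fintype.sum_prod_type',
      ← ((Equiv.arrowCongr (Equiv.refl (Fin 3)) bits).trans
        (Equiv.arrowProdEquivProdArrow _ _ _)).sum_comp]
    refine Finset.sum_congr rfl fun a _ => ?_
    rw [Nat.cast_ite, Nat.cast_one, Nat.cast_zero, mul_comm]
    rfl
  · simp only [if_neg hP, Finset.sum_const_zero]

/-! ### The fifteen pairings of the sides of the hexagon. -/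

/-- The shapes of the three faces of a hexagon. -/
abbrev ShapeTriple : Type := Shape × Shape × Shape

namespace ShapeTriple

def toFun (p : ShapeTriple) : Fin 3 → Shape := ![p.1, p.2.1, p.2.2]

/-- The sides that are visited, starting from the side `s` and leaving the hexagon or being stopped
after `n + 1` faces. -/
def trace (p : ShapeTriple) : ℕ → Fin 3 × Fin 4 → List (Fin 3 × Fin 4)
  | 0, s => [s, (s.1, (p.toFun s.1).partner s.2)]
  | n + 1, s =>
    let i := (p.toFun s.1).partner s.2
    s :: (s.1, i) :: if i = 0 then trace p n (s.1 + 1, 3)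
      else if i = 3 then trace p n (s.1 + 2, 0) else []

theorem reflTransGen_of_mem_trace (p : ShapeTriple) (n : ℕ) (s y : Fin 3 × Fin 4)
    (h : y ∈ p.trace n s) :
    Relation.ReflTransGen (StarStep fun j => (p.toFun j).partner) s y := by
  have hstep : ∀ s : Fin 3 × Fin 4, StarStep (fun j => (p.toFun j).partner) s
      (s.1, (p.toFun s.1).partner s.2) := fun s => .inl rfl
  induction n generalizing s with
  | zero =>
    rcases List.mem_cons.1 h with rfl | h
    · exact .refl
    · obtain rfl := List.mem_singleton.1 h
      exact .single (hstep s)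
  | succ n ih =>
    rw [trace] at h
    rcases List.mem_cons.1 h with rfl | h
    · exact .refl
    rcases List.mem_cons.1 h with rfl | h
    · exact .single (hstep s)
    refine .head (hstep s) ?_
    split_ifs at h with h0 h3
    · exact .head (.inr (.inl ⟨h0, rfl⟩)) (ih _ h)
    · exact .head (.inr (.inr ⟨h3, rfl⟩)) (ih _ h)
    · simp at h

/-- The traced list is closed under all steps, hence it contains everything reachable. Four faces
suffice: the longest path enters a face, goes around the center through the two other faces and
leaves through the first one. -/
theorem trace_closed : ∀ (p : ShapeTriple) (e : HexSide), ∀ y ∈ p.trace 3 e.toSide,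
    (y.1, (p.toFun y.1).partner y.2) ∈ p.trace 3 e.toSide ∧
      (y.2 = 0 → (y.1 + 1, 3) ∈ p.trace 3 e.toSide) ∧
      (y.2 = 3 → (y.1 + 2, 0) ∈ p.trace 3 e.toSide) := by
  decide +kernel

theorem hexConnected_iff (p : ShapeTriple) (e e' : HexSide) :
    HexConnected (fun j => (p.toFun j).partner) e e' ↔ e'.toSide ∈ p.trace 3 e.toSide := by
  refine ⟨fun h => ?_, reflTransGen_of_mem_trace p 3 _ _⟩
  rw [HexConnected] at h
  generalize e'.toSide = s at h ⊢
  induction h with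
  | refl => exact List.mem_cons_self
  | @tail y z _ hstep ih =>
    obtain ⟨h1, h2, h3⟩ := p.trace_closed e y ih
    rcases hstep with rfl | ⟨h, rfl⟩ | ⟨h, rfl⟩
    exacts [h1, h2 h, h3 h]

end ShapeTriple

/-- The shapes for each of the fifteen ways to connect the sides of the hexagon in pairs. -/
def shapeClass : Fin 15 → List ShapeTriple :=
  ![[(.one, .one, .one)],
    [(.one, .one, .two), (.cross, .cross, .two)],
    [(.one, .one, .cross)],
    [(.one, .two, .one), (.cross, .two, .cross)],
    [(.one, .two, .two), (.two, .one, .two), (.two, .two, .one), (.two, .two, .two),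
      (.two, .two, .cross), (.two, .cross, .two), (.cross, .two, .two)],
    [(.one, .two, .cross), (.cross, .two, .one)],
    [(.one, .cross, .one)],
    [(.one, .cross, .two), (.cross, .one, .two)],
    [(.one, .cross, .cross)],
    [(.two, .one, .one), (.two, .cross, .cross)],
    [(.two, .one, .cross), (.two, .cross, .one)],
    [(.cross, .one, .one)],
    [(.cross, .one, .cross)],
    [(.cross, .cross, .one)],
    [(.cross, .cross, .cross)]]

/-- The six sides of the hexagon in a fixed order. -/
def hexSides : Fin 6 → HexSide := ![(0, 0), (0, 1), (1, 0), (1, 1), (2, 0), (2, 1)]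

/-- The side of the hexagon to which a side is connected. -/
def hexPartner (k : Fin 15) (e : HexSide) : HexSide :=
  hexSides ((![![3, 4, 5, 0, 1, 2], ![3, 2, 1, 0, 5, 4], ![3, 5, 4, 0, 2, 1], ![5, 4, 3, 2, 1, 0],
    ![1, 0, 3, 2, 5, 4], ![4, 5, 3, 2, 0, 1], ![2, 4, 0, 5, 1, 3], ![2, 3, 0, 1, 5, 4],
    ![2, 5, 0, 4, 3, 1], ![1, 0, 5, 4, 3, 2], ![1, 0, 4, 5, 2, 3], ![4, 3, 5, 1, 0, 2],
    ![5, 3, 4, 1, 2, 0], ![4, 2, 1, 5, 0, 3], ![5, 2, 1, 4, 3, 0]] :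
      Fin 15 → Fin 6 → Fin 6) k (finProdFinEquiv e))

/-- The connections at the sides of the hexagon. -/
def HexRel (k : Fin 15) (e e' : HexSide) : Prop := e' = e ∨ e' = hexPartner k e

/-- The rotation of the hexagon by a half-turn. -/
def hexFlip : Equiv.Perm HexSide where
  toFun := fun e => hexSides (![5, 2, 1, 4, 3, 0] (finProdFinEquiv e))
  invFun := fun e => hexSides (![5, 2, 1, 4, 3, 0] (finProdFinEquiv e))
  left_inv := by decide
  right_inv := by decide

/-- The half-turn of the hexagon acts on the fifteen ways to connect its sides. -/
def flipClass : Equiv.Perm (Fin 15) where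
  toFun := ![4, 1, 7, 3, 0, 6, 5, 2, 8, 9, 11, 10, 12, 13, 14]
  invFun := ![4, 1, 7, 3, 0, 6, 5, 2, 8, 9, 11, 10, 12, 13, 14]
  left_inv := by decide
  right_inv := by decide

theorem hexPartner_flipClass : ∀ k e,
    hexPartner (flipClass k) (hexFlip e) = hexFlip (hexPartner k e) := by
  decide +kernel

theorem hexRel_flipClass (k : Fin 15) (e e' : HexSide) :
    HexRel (flipClass k) (hexFlip e) (hexFlip e') ↔ HexRel k e e' := by
  simp only [HexRel, hexPartner_flipClass, hexFlip.apply_eq_iff_eq]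

theorem mem_trace_iff : ∀ k, ∀ p ∈ shapeClass k, ∀ e e' : HexSide,
    e'.toSide ∈ p.trace 3 e.toSide ↔ e' = e ∨ e' = hexPartner k e := by
  decide +kernel

theorem hexConnected_eq {k : Fin 15} {p : ShapeTriple} (hp : p ∈ shapeClass k) :
    (HexConnected fun j => (p.toFun j).partner) = HexRel k := by
  funext e e'
  exact propext ((p.hexConnected_iff e e').trans (mem_trace_iff k p hp e e'))

theorem sum_shapeTriple (f : ShapeTriple → ℝ) :
    ∑ p, f p = ∑ k, ((shapeClass k).map f).sum := by
  have hnodup : ((List.finRange 15).flatMap shapeClass).Nodup := by decide +kernel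
  have hmem : ∀ p, p ∈ (List.finRange 15).flatMap shapeClass := by decide +kernel
  have h : (Finset.univ : Finset ShapeTriple) = ((List.finRange 15).flatMap shapeClass).toFinset :=
    (Finset.eq_univ_iff_forall.2 fun p => List.mem_toFinset.2 (hmem p)).symm
  rw [h, List.sum_toFinset f hnodup, List.map_flatMap, List.flatMap_def, List.sum_flatten, List.map_map,
    Fin.sum_univ_def]
  rfl

theorem sum_fin_three_fun {α M : Type*} [Fintype α] [AddCommMonoid M] (f : (Fin 3 → α) → M) :
    ∑ a, f a = ∑ a : α × α × α, f ![a.1, a.2.1, a.2.2] := by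
  let ε : α × α × α ≃ (Fin 3 → α) :=
    { toFun := fun a => ![a.1, a.2.1, a.2.2]
      invFun := fun a => (a 0, a 1, a 2)
      left_inv := fun _ => rfl
      right_inv := fun a => by ext j; fin_cases j <;> rfl }
  exact (ε.sum_comp f).symm

/-- The number of loops around the center when its three neighboring faces have the given shapes,
counted with the two indices. -/
def loopFactor (p : ShapeTriple) : ℕ := if p = (.two, .two, .two) then 2 else 1

/-- Boolean values on the sides of the hexagon, in a fixed order. -/
abbrev HexBits : Type := Bool × Bool × Bool × Bool × Bool × Bool

namespace HexBits

def toFun (c : HexBits) : HexSide → Bool := fun e =>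
  (![![c.1, c.2.1], ![c.2.2.1, c.2.2.2.1], ![c.2.2.2.2.1, c.2.2.2.2.2]] : Fin 3 → Fin 2 → Bool) e.1 e.2

def ofFun (c : HexSide → Bool) : HexBits :=
  (c (0, 0), c (0, 1), c (1, 0), c (1, 1), c (2, 0), c (2, 1))

theorem toFun_ofFun (c : HexSide → Bool) : (ofFun c).toFun = c := by
  funext ⟨j, i⟩
  fin_cases j <;> fin_cases i <;> rfl

def flip (c : HexBits) : HexBits :=
  (c.2.2.2.2.2, c.2.2.1, c.2.1, c.2.2.2.2.1, c.2.2.2.1, c.1)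

theorem toFun_flip (c : HexBits) : c.flip.toFun = c.toFun ∘ hexFlip := by
  funext ⟨j, i⟩
  fin_cases j <;> fin_cases i <;> rfl

end HexBits

/-- The eight triples of Boolean values. -/
def boolTriples : List (Bool × Bool × Bool) :=
  [(false, false, false), (false, false, true), (false, true, false), (false, true, true),
    (true, false, false), (true, false, true), (true, true, false), (true, true, true)]

theorem sum_bool_fun {M : Type*} [AddCommMonoid M] (f : (Fin 3 → Bool) → M) :
    ∑ a, f a = (boolTriples.map fun a => f ![a.1, a.2.1, a.2.2]).sum := by
  have h : (Finset.univ : Finset (Bool × Bool × Bool)) = boolTriples.toFinset := by decide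
  rw [sum_fin_three_fun, h, List.sum_toFinset _ (by decide)]

/-- The number of ways to mark the three edges at the center. -/
def markList (p : ShapeTriple) (β : HexBits) : ℕ :=
  (boolTriples.map fun a =>
    bif p.1.marksOk a.1 β.1 β.2.1 a.2.2 && (p.2.1.marksOk a.2.1 β.2.2.1 β.2.2.2.1 a.1 &&
      p.2.2.marksOk a.2.2 β.2.2.2.2.1 β.2.2.2.2.2 a.2.1) then 1 else 0).sum

theorem markCount_eq (p : ShapeTriple) (β : HexBits) :
    markCount p.toFun β.toFun = markList p β := by
  rw [markCount, sum_bool_fun, markList]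
  refine congrArg List.sum (List.map_congr_left fun a _ => ?_)
  rw [cond_eq_ite]
  refine if_congr ?_ rfl rfl
  rw [Fin.forall_fin_succ, Fin.forall_fin_succ, Fin.forall_fin_succ, Bool.and_eq_true,
    Bool.and_eq_true]
  exact ⟨fun h => ⟨h.1, h.2.1, h.2.2.1⟩, fun h => ⟨h.1, h.2.1, h.2.2, fun j => j.elim0⟩⟩

-- Along a path the mark is switched once per crossing. The parity of the crossings of two paths in
-- a disk depends only on whether their ends interlace, and a self-crossing is passed twice. So the
-- admissible boundary marks depend only on the pairing and are respected by the half-turn. The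
-- inner marks are then determined, except for the free mark of a closed loop.
set_option synthInstance.maxHeartbeats 200000 in
set_option synthInstance.maxSize 1000 in
theorem markList_cases : ∀ (k : Fin 15) (β : HexBits),
    ((∀ p ∈ shapeClass k, markList p β = 0) ∧
      ∀ p ∈ shapeClass (flipClass k), markList p β.flip = 0) ∨
    ((∀ p ∈ shapeClass k, markList p β = loopFactor p) ∧
      ∀ p ∈ shapeClass (flipClass k), markList p β.flip = loopFactor p) := by
  decide +kernel

/-! ### Color sums as lists of types. -/

/-- The kinds of the configurations at the three faces, for given shapes and given colors at the
hexagon. -/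
def kindList (p : ShapeTriple) (c : HexBits) : List (Fin 5 × Fin 5 × Fin 5) :=
  boolTriples.filterMap fun a =>
    (p.1.kind a.1 c.1 c.2.1 a.2.2).bind fun x =>
      (p.2.1.kind a.2.1 c.2.2.1 c.2.2.2.1 a.1).bind fun y =>
        (p.2.2.kind a.2.2 c.2.2.2.2.1 c.2.2.2.2.2 a.2.1).map fun z => (x, y, z)

/-- The product of the weights of the configurations at the three faces. -/
def tripleWeight (ω : Fin 3 → Fin 5 → ℝ) (τ : Fin 5 × Fin 5 × Fin 5) : ℝ :=
  ω 0 τ.1 * ω 1 τ.2.1 * ω 2 τ.2.2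

theorem colorSum_eq (ω : Fin 3 → Fin 5 → ℝ) (p : ShapeTriple) (c : HexBits) :
    colorSum ω p.toFun c.toFun = ((kindList p c).map (tripleWeight ω)).sum := by
  have key : ∀ (l : List (Bool × Bool × Bool)) (f : Bool × Bool × Bool → Option (Fin 5 × Fin 5 × Fin 5)),
      ((l.filterMap f).map (tripleWeight ω)).sum =
        (l.map fun a => (f a).elim 0 (tripleWeight ω)).sum := by
    intro l f
    induction l with
    | nil => rfl
    | cons a l ih =>
      rw [List.filterMap_cons, List.map_cons, List.sum_cons, ← ih]
      cases f a <;> simp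
  rw [colorSum, sum_bool_fun, kindList, key]
  refine congrArg List.sum (List.map_congr_left fun a _ => ?_)
  rw [Fin.prod_univ_three]
  change kindWeight (ω 0) (p.1.kind a.1 c.1 c.2.1 a.2.2) *
    kindWeight (ω 1) (p.2.1.kind a.2.1 c.2.2.1 c.2.2.2.1 a.1) *
      kindWeight (ω 2) (p.2.2.kind a.2.2 c.2.2.2.2.1 c.2.2.2.2.2 a.2.1) = _
  generalize p.1.kind a.1 c.1 c.2.1 a.2.2 = o₀
  generalize p.2.1.kind a.2.1 c.2.2.1 c.2.2.2.1 a.1 = o₁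
  generalize p.2.2.kind a.2.2 c.2.2.2.2.1 c.2.2.2.2.2 a.2.1 = o₂
  cases o₀ <;> cases o₁ <;> cases o₂ <;> simp [kindWeight, tripleWeight]

/-- The kinds of the configurations at the three faces, for given connections and given colors at
the hexagon, where configurations with a loop are listed twice. -/
def classKinds (k : Fin 15) (c : HexBits) : List (Fin 5 × Fin 5 × Fin 5) :=
  (shapeClass k).flatMap fun p => (List.replicate (loopFactor p) (kindList p c)).flatten

/-- The sum of the weights for given connections and given colors at the hexagon. -/
def classSum (ω : Fin 3 → Fin 5 → ℝ) (k : Fin 15) (c : HexBits) : ℝ :=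
  ((classKinds k c).map (tripleWeight ω)).sum

theorem classSum_eq (ω : Fin 3 → Fin 5 → ℝ) (k : Fin 15) (c : HexBits) :
    classSum ω k c =
      ((shapeClass k).map fun p => (loopFactor p : ℝ) * colorSum ω p.toFun c.toFun).sum := by
  rw [classSum, classKinds, List.map_flatMap, List.flatMap_def, List.sum_flatten, List.map_map]
  refine congrArg List.sum (List.map_congr_left fun p _ => ?_)
  rw [colorSum_eq, Function.comp_apply, List.map_flatten, List.sum_flatten, List.map_replicate,
    List.map_replicate, List.sum_replicate, nsmul_eq_mul]

-- All shapes of a class induce the same relation `HexRel k`, so the condition `P` is constant on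
-- the class and can be tested before summing over it.
open Classical in
theorem hexagonSum_eq_sum_class (ω : Fin 3 → Fin 5 → ℝ)
    (P : (HexSide → LoopIndex) → (HexSide → HexSide → Prop) → Prop) :
    hexagonSum (fun j c => ω j c.kind) P =
      ∑ k, ∑ b : HexSide → LoopIndex, if P b (HexRel k) then
        ((shapeClass k).map fun p => markList p (.ofFun fun e => (b e).mark) *
          colorSum ω p.toFun fun e => (b e).col).sum else 0 := by
  rw [hexagonSum_eq_sum_shape, sum_fin_three_fun]
  refine (sum_shapeTriple _).trans (Finset.sum_congr rfl fun k _ => ?_)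
  have h : ∀ p ∈ shapeClass k, (∑ b : HexSide → LoopIndex,
      if P b (HexConnected fun j => (![p.1, p.2.1, p.2.2] j).partner) then
        (markCount ![p.1, p.2.1, p.2.2] fun e => (b e).mark) *
          colorSum ω ![p.1, p.2.1, p.2.2] (fun e => (b e).col) else 0) =
      ∑ b : HexSide → LoopIndex, if P b (HexRel k) then
        markList p (.ofFun fun e => (b e).mark) *
          colorSum ω p.toFun fun e => (b e).col else 0 := by
    intro p hp
    refine Finset.sum_congr rfl fun b _ => ?_
    rw [← hexConnected_eq hp, ← markCount_eq, HexBits.toFun_ofFun]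
    rfl
  rw [List.map_congr_left h]
  generalize shapeClass k = l
  induction l with
  | nil => simp
  | cons p l ih =>
    rw [List.map_cons, List.sum_cons, ih, ← Finset.sum_add_distrib]
    refine Finset.sum_congr rfl fun b _ => ?_
    split_ifs <;> simp

/-- If the sums of the weights agree for all connections and colors, then they agree for all
conditions. -/
theorem hexagonSum_flip {ω ω' : Fin 3 → Fin 5 → ℝ} {r r' : ℝ}
    (h : ∀ k c, r * classSum ω k c = r' * classSum ω' (flipClass k) c.flip)
    (P : (HexSide → LoopIndex) → (HexSide → HexSide → Prop) → Prop) :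
    r * hexagonSum (fun j c => ω j c.kind) P =
      r' * hexagonSum (fun j c => ω' j c.kind)
        fun b M => P (b ∘ hexFlip) fun e e' => M (hexFlip e) (hexFlip e') := by
  classical
  rw [hexagonSum_eq_sum_class, hexagonSum_eq_sum_class, Finset.mul_sum, Finset.mul_sum]
  -- On the right, pairings and then boundary indices are reindexed by the half-turn, after which
  -- `P` is tested on the same data on both sides.
  refine Eq.trans ?_ (Equiv.sum_comp flipClass _)
  refine Finset.sum_congr rfl fun k _ => ?_
  rw [Finset.mul_sum, Finset.mul_sum]
  refine Eq.trans ?_ ((Equiv.arrowCongr hexFlip (Equiv.refl LoopIndex)).sum_comp _)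
  refine Finset.sum_congr rfl fun b _ => ?_
  have hb : Equiv.arrowCongr hexFlip (Equiv.refl LoopIndex) b = b ∘ hexFlip := rfl
  have hbb : (b ∘ hexFlip) ∘ hexFlip = b := funext fun e => congrArg b (hexFlip.left_inv e)
  simp only [hb, hbb, hexRel_flipClass]
  change r * (if P b (HexRel k) then _ else _) = r' * (if P b (HexRel k) then _ else _)
  split_ifs with hP
  · have hflip : ∀ f : LoopIndex → Bool, (HexBits.ofFun fun e => f ((b ∘ hexFlip) e)) =
      (HexBits.ofFun fun e => f (b e)).flip := fun f => rfl
    have hcol : ∀ f : LoopIndex → Bool, (fun e => f ((b ∘ hexFlip) e)) =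
      (HexBits.ofFun fun e => f (b e)).flip.toFun := fun f => by
        rw [HexBits.toFun_flip, HexBits.toFun_ofFun]; rfl
    rw [hflip, hcol LoopIndex.col]
    -- Either the marks kill both sides, or they leave exactly the loop factors that are built into
    -- `classSum`.
    rcases markList_cases k (.ofFun fun e => (b e).mark) with ⟨h1, h2⟩ | ⟨h1, h2⟩
    · rw [List.map_congr_left (g := fun _ => (0 : ℝ)) fun p hp => by rw [h1 p hp]; simp,
        List.map_congr_left (l := shapeClass (flipClass k)) (g := fun _ => (0 : ℝ))
          fun p hp => by rw [h2 p hp]; simp]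
      simp
    · rw [List.map_congr_left fun p hp => by rw [h1 p hp],
        List.map_congr_left (l := shapeClass (flipClass k)) fun p hp => by rw [h2 p hp]]
      have := h k (.ofFun fun e => (b e).col)
      rwa [classSum_eq, classSum_eq, HexBits.toFun_ofFun] at this
  · rw [mul_zero, mul_zero]

/-! ### The Yang–Baxter equations as polynomial identities. -/

/-- The weights of the five types of local configurations, where `a ^ 2` and `b ^ 2` are the
weights of the first two types. -/
def kindWeights (a b W : ℝ) : Fin 5 → ℝ := ![a ^ 2, b ^ 2, a * W, b * W, a * b]

theorem LocalConf.weight_eq_kindWeights (c : LocalConf) {x u y v : ℝ} (hx : 0 < x) (hu : 0 < u)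
    (hy : 0 < y) (hv : 0 < v) :
    c.weight x u y v = kindWeights (√x * √y) (√v * √u) √(x * y + u * v) c.kind := by
  have h1 : x * y = (√x * √y) ^ 2 := by
    rw [mul_pow, Real.sq_sqrt hx.le, Real.sq_sqrt hy.le]
  have h2 : u * v = (√v * √u) ^ 2 := by
    rw [mul_pow, Real.sq_sqrt hu.le, Real.sq_sqrt hv.le, mul_comm]
  have h3 : √(x * y) = √x * √y := Real.sqrt_mul hx.le _
  have h4 : √(v * u) = √v * √u := Real.sqrt_mul hv.le _
  have h5 : √(x * y * u * v) = (√x * √y) * (√v * √u) := by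
    rw [mul_assoc, Real.sqrt_mul (mul_pos hx hy).le, mul_comm u v, h3, h4]
  cases c
  all_goals
    first
    | exact h1
    | exact h2
    | exact h5
    | exact congrArg (· * _) h3
    | exact congrArg (· * _) h4

/-- The square roots of the variables at the vertices of a cube and of the sums at its faces, where
`s` and `t` belong to the two vertices that are exchanged by the flip, `a j` to the neighbors of the
first one, and `b j` to the neighbors of the second one. -/
structure IsKashaevCube (s t : ℝ) (a b X X' : Fin 3 → ℝ) : Prop where
  pos : 0 < s
  pos' : 0 < t
  sq_face : ∀ j, X j ^ 2 = s ^ 2 * b j ^ 2 + a (j + 1) ^ 2 * a (j + 2) ^ 2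
  face_flip : ∀ j, s ^ 2 * X' j = a j ^ 2 * X j + X (j + 1) * X (j + 2)
  center_flip : s ^ 4 * t ^ 2 = 2 * (a 0 * a 1 * a 2) ^ 2 +
    s ^ 2 * (a 0 ^ 2 * b 0 ^ 2 + a 1 ^ 2 * b 1 ^ 2 + a 2 ^ 2 * b 2 ^ 2) + 2 * (X 0 * X 1 * X 2)

/-- The weights at the three faces before the flip, and after the flip with the roles of the
variables exchanged. -/
def cubeWeights (s : ℝ) (a b X : Fin 3 → ℝ) (j : Fin 3) : Fin 5 → ℝ :=
  kindWeights (s * b j) (a (j + 1) * a (j + 2)) (X j)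

theorem IsKashaevCube.rotate {s t : ℝ} {a b X X' : Fin 3 → ℝ} (h : IsKashaevCube s t a b X X') :
    IsKashaevCube s t (fun j => a (j + 2)) (fun j => b (j + 2)) (fun j => X (j + 2))
      fun j => X' (j + 2) where
  pos := h.pos
  pos' := h.pos'
  sq_face j := by
    have := h.sq_face (j + 2)
    rwa [add_right_comm j 2 1] at this
  face_flip j := by
    have := h.face_flip (j + 2)
    rwa [add_right_comm j 2 1] at this
  center_flip := by
    have := h.center_flip
    simp only [show (0 : Fin 3) + 2 = 2 from rfl, show (1 : Fin 3) + 2 = 0 from rfl,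
      show (2 : Fin 3) + 2 = 1 from rfl]
    linarith

/-- The Yang-Baxter equations, as lists of types of local configurations before and after the flip,
up to rotations. -/
def yangBaxterTable : List (List (Fin 5 × Fin 5 × Fin 5) × List (Fin 5 × Fin 5 × Fin 5)) :=
  [([], []),
    ([(0, 0, 0)], [(0, 1, 1), (1, 0, 1), (1, 1, 0), (1, 1, 1), (1, 1, 1), (3, 3, 3), (3, 3, 3)]),
    ([(0, 0, 1)], [(0, 0, 1)]),
    ([(0, 0, 3)], [(2, 2, 1), (4, 4, 3)]),
    ([(0, 1, 1), (1, 0, 1), (1, 1, 0), (1, 1, 1), (1, 1, 1), (3, 3, 3), (3, 3, 3)], [(0, 0, 0)]),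
    ([(0, 1, 3), (1, 0, 3), (1, 1, 3), (1, 1, 3), (3, 3, 0), (3, 3, 1), (3, 3, 1)], [(2, 2, 0)]),
    ([(0, 2, 2)], [(0, 3, 3), (1, 3, 3), (1, 3, 3), (3, 0, 1), (3, 1, 0), (3, 1, 1), (3, 1, 1)]),
    ([(0, 2, 4)], [(2, 4, 3), (4, 2, 1)]),
    ([(0, 4, 2)], [(2, 3, 4), (4, 1, 2)]),
    ([(0, 4, 4)], [(0, 4, 4)]),
    ([(1, 2, 2), (3, 4, 4)], [(3, 0, 0)]),
    ([(1, 2, 4), (3, 4, 2)], [(4, 2, 0)]),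
    ([(1, 4, 2), (3, 2, 4)], [(4, 0, 2)]),
    ([(1, 4, 4), (3, 2, 2)], [(1, 4, 4), (3, 2, 2)])]

theorem IsKashaevCube.table {s t : ℝ} {a b X X' : Fin 3 → ℝ} (h : IsKashaevCube s t a b X X') :
    ∀ e ∈ yangBaxterTable, 1 / (s ^ 2) ^ 2 * (e.1.map (tripleWeight (cubeWeights s a b X))).sum =
      1 / (t ^ 2) ^ 2 * (e.2.map (tripleWeight (cubeWeights t b a X'))).sum := by
  have key : ∀ {x y : ℝ}, x * t ^ 4 = y * s ^ 4 → 1 / (s ^ 2) ^ 2 * x = 1 / (t ^ 2) ^ 2 * y := by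
    intro x y hxy
    have hs := h.pos.ne'
    have ht := h.pos'.ne'
    field_simp
    rw [hxy, mul_comm]
  have hX0 := h.sq_face 0
  have hX1 := h.sq_face 1
  have hX2 := h.sq_face 2
  have hF0 := h.face_flip 0
  have hF1 := h.face_flip 1
  have hF2 := h.face_flip 2
  have hC := h.center_flip
  have hs := h.pos.ne'
  have ht := h.pos'.ne'
  simp only [yangBaxterTable, List.forall_mem_cons, List.map_cons, List.map_nil, List.sum_cons,
    List.sum_nil, tripleWeight, cubeWeights, kindWeights]
  simp only [show (0 : Fin 3) + 1 = 1 from rfl, show (0 : Fin 3) + 2 = 2 from rfl,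
    show (1 : Fin 3) + 1 = 2 from rfl, show (1 : Fin 3) + 2 = 0 from rfl,
    show (2 : Fin 3) + 1 = 0 from rfl, show (2 : Fin 3) + 2 = 1 from rfl] at *
  generalize a 0 = a0 at *
  generalize a 1 = a1 at *
  generalize a 2 = a2 at *
  generalize b 0 = b0 at *
  generalize b 1 = b1 at *
  generalize b 2 = b2 at *
  generalize X 0 = X0 at *
  generalize X 1 = X1 at *
  generalize X 2 = X2 at *
  generalize X' 0 = Y0 at *
  generalize X' 1 = Y1 at *
  generalize X' 2 = Y2 at *
  refine ⟨by simp, ?_, ?_, ?_, ?_, ?_, ?_, ?_, ?_, ?_, ?_, ?_, ?_, ?_, by simp⟩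
  -- With denominators cleared, each entry is a polynomial identity in the square roots that follows
  -- from the relations for `X j ^ 2`, for `s ^ 2 * X' j` and for `s ^ 4 * t ^ 2`, given that `s`
  -- and `t` are nonzero.
  all_goals
    refine key ?_
    simp only [Matrix.cons_val]
    clear key h
    grind

/-- A finite check that reduces all equations, one for each pairing and each coloring of the six
sides, to the table and its cyclic rotations. -/
theorem classKinds_table : ∀ (k : Fin 15) (c : HexBits), ∃ e ∈ yangBaxterTable, ∃ i : Fin 3,
    (classKinds k c).Perm (e.1.map (fun τ => (τ.2.1, τ.2.2, τ.1))^[i]) ∧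
      (classKinds (flipClass k) c.flip).Perm (e.2.map (fun τ => (τ.2.1, τ.2.2, τ.1))^[i]) := by
  decide +kernel

/-- Rotating the triple of types amounts to shifting the indices of `a`, `b`, `X` by two, and the
relations of the cube are invariant under this shift; so the unrotated table is enough. -/
theorem IsKashaevCube.classSum_eq {s t : ℝ} {a b X X' : Fin 3 → ℝ}
    (h : IsKashaevCube s t a b X X') (k : Fin 15) (c : HexBits) :
    1 / (s ^ 2) ^ 2 * classSum (cubeWeights s a b X) k c =
      1 / (t ^ 2) ^ 2 * classSum (cubeWeights t b a X') (flipClass k) c.flip := by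
  obtain ⟨e, he, i, h1, h2⟩ := classKinds_table k c
  rw [classSum, classSum, (h1.map _).sum_eq, (h2.map _).sum_eq, List.map_map, List.map_map]
  clear h1 h2
  have hrot : ∀ (s : ℝ) (a b X : Fin 3 → ℝ), tripleWeight (cubeWeights s a b X) ∘
      (fun τ => (τ.2.1, τ.2.2, τ.1)) = tripleWeight (cubeWeights s (fun j => a (j + 2))
        (fun j => b (j + 2)) fun j => X (j + 2)) := by
    intro s a b X
    funext τ
    simp only [Function.comp_apply, tripleWeight, cubeWeights]
    exact (mul_comm _ _).trans (mul_assoc _ _ _).symm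
  obtain ⟨i, hi⟩ := i
  change 1 / (s ^ 2) ^ 2 * (e.1.map (_ ∘ (_^[i]))).sum = 1 / (t ^ 2) ^ 2 * (e.2.map (_ ∘ (_^[i]))).sum
  clear hi
  induction i generalizing a b X X' with
  | zero => exact h.table e he
  | succ i ih =>
    rw [Function.iterate_succ', ← Function.comp_assoc, ← Function.comp_assoc, hrot, hrot]
    exact ih h.rotate

/-- The relation `face_flip` is the point: the recurrence turns $g_x^2(g'_xg_1+g_{12}g_{13})$ into
the perfect square $(g_1X+YZ)^2$, and positivity selects the root. -/
theorem KashaevRecurrence.isKashaevCube {g g1 g2 g3 g12 g13 g23 g' : ℝ} (hg : 0 < g) (hg1 : 0 < g1)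
    (hg2 : 0 < g2) (hg3 : 0 < g3) (hg12 : 0 < g12) (hg13 : 0 < g13) (hg23 : 0 < g23) (hg' : 0 < g')
    (h : KashaevRecurrence g g1 g2 g3 g12 g13 g23 g') :
    IsKashaevCube √g √g' ![√g1, √g2, √g3] ![√g23, √g13, √g12]
      ![√(g * g23 + g3 * g2), √(g * g13 + g1 * g3), √(g * g12 + g2 * g1)]
      ![√(g' * g1 + g12 * g13), √(g' * g2 + g23 * g12), √(g' * g3 + g13 * g23)] := by
  have hrec : g ^ 2 * g' = 2 * g1 * g2 * g3 + g * (g1 * g23 + g2 * g13 + g3 * g12) +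
      2 * √(g * g23 + g3 * g2) * √(g * g13 + g1 * g3) * √(g * g12 + g2 * g1) := by
    rw [h, mul_div_cancel₀ _ (pow_pos hg 2).ne', mul_comm g3 g2, mul_comm g2 g1]
  have hX : √(g * g23 + g3 * g2) ^ 2 = g * g23 + g3 * g2 := Real.sq_sqrt (by positivity)
  have hY : √(g * g13 + g1 * g3) ^ 2 = g * g13 + g1 * g3 := Real.sq_sqrt (by positivity)
  have hZ : √(g * g12 + g2 * g1) ^ 2 = g * g12 + g2 * g1 := Real.sq_sqrt (by positivity)
  have hX0 : 0 ≤ √(g * g23 + g3 * g2) := Real.sqrt_nonneg _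
  have hY0 : 0 ≤ √(g * g13 + g1 * g3) := Real.sqrt_nonneg _
  have hZ0 : 0 ≤ √(g * g12 + g2 * g1) := Real.sqrt_nonneg _
  generalize √(g * g23 + g3 * g2) = X at *
  generalize √(g * g13 + g1 * g3) = Y at *
  generalize √(g * g12 + g2 * g1) = Z at *
  have root : ∀ {y z : ℝ}, 0 ≤ z → g ^ 2 * y = z ^ 2 → g * √y = z := by
    intro y z hz hy
    rw [← Real.sqrt_sq hz, ← hy, Real.sqrt_mul (sq_nonneg g), Real.sqrt_sq hg.le]
  refine ⟨Real.sqrt_pos.2 hg, Real.sqrt_pos.2 hg', ?_, ?_, ?_⟩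
  · rw [Fin.forall_fin_succ, Fin.forall_fin_succ, Fin.forall_fin_succ]
    refine ⟨?_, ?_, ?_, fun j => j.elim0⟩
    · change X ^ 2 = √g ^ 2 * √g23 ^ 2 + √g2 ^ 2 * √g3 ^ 2
      simp only [Real.sq_sqrt, hg.le, hg2.le, hg3.le, hg23.le]
      linarith
    · change Y ^ 2 = √g ^ 2 * √g13 ^ 2 + √g3 ^ 2 * √g1 ^ 2
      simp only [Real.sq_sqrt, hg.le, hg1.le, hg3.le, hg13.le]
      linarith
    · change Z ^ 2 = √g ^ 2 * √g12 ^ 2 + √g1 ^ 2 * √g2 ^ 2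
      simp only [Real.sq_sqrt, hg.le, hg2.le, hg1.le, hg12.le]
      linarith
  · rw [Fin.forall_fin_succ, Fin.forall_fin_succ, Fin.forall_fin_succ]
    refine ⟨?_, ?_, ?_, fun j => j.elim0⟩
    · change √g ^ 2 * √(g' * g1 + g12 * g13) = √g1 ^ 2 * X + Y * Z
      rw [Real.sq_sqrt hg.le, Real.sq_sqrt hg1.le]
      refine root (by positivity) ?_
      linear_combination g1 * hrec - g1 ^ 2 * hX - Y ^ 2 * hZ - (g * g12 + g2 * g1) * hY
    · change √g ^ 2 * √(g' * g2 + g23 * g12) = √g2 ^ 2 * Y + Z * X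
      rw [Real.sq_sqrt hg.le, Real.sq_sqrt hg2.le]
      refine root (by positivity) ?_
      linear_combination g2 * hrec - g2 ^ 2 * hY - Z ^ 2 * hX - (g * g23 + g3 * g2) * hZ
    · change √g ^ 2 * √(g' * g3 + g13 * g23) = √g3 ^ 2 * Z + X * Y
      rw [Real.sq_sqrt hg.le, Real.sq_sqrt hg3.le]
      refine root (by positivity) ?_
      linear_combination g3 * hrec - g3 ^ 2 * hZ - X ^ 2 * hY - (g * g13 + g1 * g3) * hX
  · change √g ^ 4 * √g' ^ 2 = 2 * (√g1 * √g2 * √g3) ^ 2 + √g ^ 2 * (√g1 ^ 2 * √g23 ^ 2 +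
      √g2 ^ 2 * √g13 ^ 2 + √g3 ^ 2 * √g12 ^ 2) + 2 * (X * Y * Z)
    rw [show √g ^ 4 = (√g ^ 2) ^ 2 by ring, mul_pow, mul_pow]
    simp only [Real.sq_sqrt, hg.le, hg1.le, hg2.le, hg3.le, hg12.le, hg13.le, hg23.le, hg'.le]
    linarith

/-! ### The converse: one boundary condition that yields the recurrence. -/

/-- A class of connections for which the sum after the flip has a single term. -/
theorem kashaevRecurrence_of_classSum_eq {g g1 g2 g3 g12 g13 g23 g' : ℝ} (hg : 0 < g)
    (hg1 : 0 < g1) (hg2 : 0 < g2) (hg3 : 0 < g3) (hg12 : 0 < g12) (hg13 : 0 < g13) (hg23 : 0 < g23)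
    (hg' : 0 < g') {X' : Fin 3 → ℝ}
    (h : 1 / g ^ 2 * classSum (cubeWeights √g ![√g1, √g2, √g3] ![√g23, √g13, √g12]
        ![√(g * g23 + g3 * g2), √(g * g13 + g1 * g3), √(g * g12 + g2 * g1)]) 4
          (.ofFun fun _ => false) =
      1 / g' ^ 2 * classSum (cubeWeights √g' ![√g23, √g13, √g12] ![√g1, √g2, √g3] X') 0
        (.ofFun fun _ => false)) :
    KashaevRecurrence g g1 g2 g3 g12 g13 g23 g' := by
  have h4 : (classKinds 4 (.ofFun fun _ => false)).Perm
      [(0, 1, 1), (1, 0, 1), (1, 1, 0), (1, 1, 1), (1, 1, 1), (3, 3, 3), (3, 3, 3)] := by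
    decide +kernel
  have h0 : classKinds 0 (.ofFun fun _ => false) = [(0, 0, 0)] := by decide +kernel
  rw [classSum, classSum, (h4.map _).sum_eq, h0] at h
  simp only [List.map_cons, List.map_nil, List.sum_cons, List.sum_nil, tripleWeight, cubeWeights,
    kindWeights] at h
  simp only [show (0 : Fin 3) + 1 = 1 from rfl, show (0 : Fin 3) + 2 = 2 from rfl,
    show (1 : Fin 3) + 1 = 2 from rfl, show (1 : Fin 3) + 2 = 0 from rfl,
    show (2 : Fin 3) + 1 = 0 from rfl, show (2 : Fin 3) + 2 = 1 from rfl, Matrix.cons_val] at h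
  rw [KashaevRecurrence, mul_comm g2 g3, mul_comm g1 g2]
  generalize √(g * g23 + g3 * g2) = X at *
  generalize √(g * g13 + g1 * g3) = Y at *
  generalize √(g * g12 + g2 * g1) = Z at *
  -- Here `i` is the square root of the new central variable. The single term on the right contains
  -- `i ^ 6`, so division by `i ^ 4` leaves an equation linear in `i ^ 2`; `e` collects all
  -- left-hand summands but the first.
  have key : ∀ a b c d e f i : ℝ, 0 < a → 0 < b → 0 < c → 0 < f → 0 < i →
      1 / (f ^ 2) ^ 2 * ((f * d) ^ 2 * (c * a) ^ 2 * (a * b) ^ 2 + e) =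
        1 / (i ^ 2) ^ 2 * ((i * a) ^ 2 * (i * b) ^ 2 * (i * c) ^ 2 + 0) →
      i ^ 2 * (a * b * c) ^ 2 * (f ^ 2) ^ 2 = (f * d) ^ 2 * (c * a) ^ 2 * (a * b) ^ 2 + e := by
    intro a b c d e f i ha hb hc hf hi h
    field_simp at h
    refine mul_left_cancel₀ (pow_pos hi 4).ne' ?_
    linear_combination -h
  have hroot : ∀ {y : ℝ}, 0 < y → ∃ a, 0 < a ∧ y = a ^ 2 :=
    fun {y} hy => ⟨√y, Real.sqrt_pos.2 hy, (Real.sq_sqrt hy.le).symm⟩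
  obtain ⟨a, ha, rfl⟩ := hroot hg1
  obtain ⟨b, hb, rfl⟩ := hroot hg2
  obtain ⟨c, hc, rfl⟩ := hroot hg3
  obtain ⟨d, hd, rfl⟩ := hroot hg23
  obtain ⟨e, he, rfl⟩ := hroot hg13
  obtain ⟨u, hu, rfl⟩ := hroot hg12
  obtain ⟨f, hf, rfl⟩ := hroot hg
  obtain ⟨i, hi, rfl⟩ := hroot hg'
  simp only [Real.sqrt_sq, ha.le, hb.le, hc.le, hd.le, he.le, hu.le, hf.le, hi.le] at h
  rw [eq_div_iff (by positivity)]
  have h' := key a b c d _ f i ha hb hc hf hi h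
  -- Every term of the equation carries the common factor $g_1g_2g_3$, which is cancelled.
  have hne : (a * b * c) ^ 2 ≠ 0 := by positivity
  refine mul_left_cancel₀ hne ?_
  linear_combination h'

/-- The sum over the configurations with given connections and with index `0` on all sides of the
hexagon. -/
theorem hexagonSum_eq_classSum {ω : Fin 3 → Fin 5 → ℝ} {k₀ : Fin 15}
    {P : (HexSide → LoopIndex) → (HexSide → HexSide → Prop) → Prop}
    (hk₀ : ∀ p ∈ shapeClass k₀, markList p (.ofFun fun _ => false) = loopFactor p)
    (hP : ∀ b k, P b (HexRel k) ↔ b = (fun _ => .redZero) ∧ k = k₀) :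
    hexagonSum (fun j c => ω j c.kind) P = classSum ω k₀ (.ofFun fun _ => false) := by
  classical
  rw [hexagonSum_eq_sum_class, Fintype.sum_eq_single k₀, Fintype.sum_eq_single fun _ => .redZero,
    if_pos ((hP _ _).2 ⟨rfl, rfl⟩), classSum_eq, HexBits.toFun_ofFun]
  · refine congrArg List.sum (List.map_congr_left fun p hp => ?_)
    rw [← hk₀ p hp]
    rfl
  · exact fun b hb => if_neg fun h => hb ((hP _ _).1 h).1
  · exact fun k hk => Finset.sum_eq_zero fun b _ => if_neg fun h => hk ((hP _ _).1 h).2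

theorem HexRel.refl (k : Fin 15) (e : HexSide) : HexRel k e e := .inl rfl

theorem hexPartner_hexPartner : ∀ k e, hexPartner k (hexPartner k e) = e := by
  decide +kernel

theorem HexRel.trans {k : Fin 15} {e e' e'' : HexSide} (h : HexRel k e e') (h' : HexRel k e' e'') :
    HexRel k e e'' := by
  rcases h with rfl | rfl
  · exact h'
  · rcases h' with rfl | rfl
    · exact .inr rfl
    · exact .inl (hexPartner_hexPartner k e)

theorem hexPartner_eq_iff : ∀ k l, (∀ e, hexPartner k e = hexPartner l e) → k = l := by
  decide +kernel

theorem hexPartner_ne : ∀ k e, hexPartner k e ≠ e := by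
  decide +kernel

theorem hexRel_injective {k l : Fin 15} (h : ∀ e e', HexRel k e e' ↔ HexRel l e e') : k = l :=
  hexPartner_eq_iff k l fun e => ((h e _).1 (.inr rfl)).resolve_left (hexPartner_ne k e)

/-- The condition that the sides of the hexagon have index `0` and given connections. -/
def hexBoundaryCondition {V : Type*} (hex : HexSide → V × V) (k : Fin 15) : BoundaryCondition V :=
  fun I C => (∀ e, (hex e, LoopIndex.redZero) ∈ I) ∧
    ∀ e e', (hex e, hex e') ∈ C ↔ HexRel k e e'

/-- Without other faces and with no two hexagon sides glued, the boundary data are exactly the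
indices and the pairing of the hexagon, so this condition isolates one pairing and one choice of
indices. -/
theorem outerCondition_hexBoundaryCondition {V F' : Type*} [IsEmpty F']
    {sd : OuterSide F' → V × V} (hinj : Function.Injective sd)
    (hext : ∀ s t, sd t ≠ (sd s).swap) (σ : F' → LocalConf) (n : F' → Fin 4 → LoopIndex)
    (k₀ : Fin 15) (b : HexSide → LoopIndex) (k : Fin 15) :
    OuterCondition sd σ n b (HexRel k) (hexBoundaryCondition (fun e => sd (.inl e)) k₀) ↔
      b = (fun _ => .redZero) ∧ k = k₀ := by
  have h1 : IsMarkedOuter sd σ n b := ⟨fun f => isEmptyElim f, fun s t h => absurd h (hext s t)⟩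
  have h2 : ∀ e i, (sd (.inl e), i) ∈ outerBoundaryIndices sd n b ↔ i = b e := by
    intro e i
    constructor
    · rintro ⟨s, -, h⟩
      obtain ⟨hs, rfl⟩ := Prod.mk.inj h
      rw [← hinj hs]
      rfl
    · rintro rfl
      exact ⟨.inl e, hext _, rfl⟩
  have h3 : ∀ e e', (sd (.inl e), sd (.inl e')) ∈ outerBoundaryConnections sd σ (HexRel k) ↔
      HexRel k e e' := by
    intro e e'
    constructor
    · rintro ⟨s, t, -, -, h, hst⟩
      obtain ⟨hs, ht⟩ := Prod.mk.inj hst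
      rw [← hinj hs, ← hinj ht] at h
      have key : ∀ u, Relation.ReflTransGen (OuterStep sd σ (HexRel k)) (.inl e) u →
          ∃ e', u = .inl e' ∧ HexRel k e e' := by
        intro u hu
        induction hu with
        | refl => exact ⟨e, rfl, .refl k e⟩
        | tail _ hstep ih =>
          obtain ⟨w, rfl, hw⟩ := ih
          rcases hstep with ⟨f, -⟩ | ⟨x, y, hx, rfl, hxy⟩ | hstep
          · exact isEmptyElim f
          · obtain rfl := Sum.inl_injective hx
            exact ⟨y, rfl, hw.trans hxy⟩
          · exact absurd hstep (hext _ _)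
      obtain ⟨w, hw, hr⟩ := key _ h
      rwa [Sum.inl_injective hw]
    · exact fun h => ⟨_, _, hext _, hext _, .single (.inr (.inl ⟨e, e', rfl, rfl, h⟩)), rfl⟩
  rw [OuterCondition, and_iff_right h1, hexBoundaryCondition]
  simp only [h2, h3]
  constructor
  · exact fun h => ⟨funext fun e => (h.1 e).symm, hexRel_injective h.2⟩
  · rintro ⟨rfl, rfl⟩
    exact ⟨fun _ => rfl, fun _ _ => Iff.rfl⟩

/-! ### Cube flips, and the proof of the theorem. -/

namespace Quadrangulation

variable {V F' : Type*}

/-- Every oriented edge leaving the center is already a side of one of the three faces, and it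
cannot be a side of a second one. Hence changing the central variable leaves the outer weights
unchanged. -/
theorem IsStar.corner_inr_ne {G : Quadrangulation V (Fin 3 ⊕ F')} {x : V}
    (hx : ∀ j, G.corner (.inl j) 0 = x)
    (hadj : ∀ v, G.graph.Adj x v → ∃ j, v = G.corner (.inl j) 1) (f : F') (i : Fin 4) :
    G.corner (.inr f) i ≠ x := by
  intro h
  obtain ⟨j, hj⟩ := hadj _ (h ▸ G.adj_corner (.inr f) i)
  have := @G.side_injective (.inr f, i) (.inl j, 0)
    (Prod.ext (h.trans (hx j).symm) hj)
  simp at this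

theorem HasCorners.ne {F : Type*} {G : Quadrangulation V F} {f f' : F} {a b c d a' b' c' d' : V}
    (h : G.HasCorners f a b c d) (h' : G.HasCorners f' a' b' c' d')
    (hne : c ∉ [a', b', c', d']) : f ≠ f' := by
  rintro rfl
  obtain ⟨k, hk⟩ := h
  obtain ⟨k', hk'⟩ := h'
  have h2 := hk 2
  have h3 := hk' (2 + k - k')
  rw [sub_add_cancel, h2] at h3
  refine hne ?_
  rw [show c = ![a', b', c', d'] (2 + k - k') from h3]
  generalize 2 + k - k' = i
  fin_cases i <;> simp

end Quadrangulation

namespace IsCubeFlip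

variable {V F : Type*} {G G' : Quadrangulation V F} {L : CubeLabels V F}

theorem faces_injective (h : IsCubeFlip G G' L) : Function.Injective ![L.fX, L.fY, L.fZ] := by
  have hn := h.nodup
  simp only [List.nodup_cons, List.mem_cons, not_or, List.not_mem_nil] at hn
  have hXY : L.fX ≠ L.fY := h.cornersX.ne h.cornersY (by
    simp only [List.mem_cons, not_or, List.not_mem_nil]; grind)
  have hYZ : L.fY ≠ L.fZ := h.cornersY.ne h.cornersZ (by
    simp only [List.mem_cons, not_or, List.not_mem_nil]; grind)
  have hZX : L.fZ ≠ L.fX := h.cornersZ.ne h.cornersX (by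
    simp only [List.mem_cons, not_or, List.not_mem_nil]; grind)
  intro i j hij
  fin_cases i <;> fin_cases j
  all_goals
    first
    | rfl
    | exact absurd hij hXY
    | exact absurd hij hYZ
    | exact absurd hij hZX
    | exact absurd hij.symm hXY
    | exact absurd hij.symm hYZ
    | exact absurd hij.symm hZX

/-- The internal faces other than the three faces of the hexagon. -/
abbrev OtherFace (L : CubeLabels V F) : Type _ := {f : F // f ≠ L.fX ∧ f ≠ L.fY ∧ f ≠ L.fZ}

/-- The internal faces, divided into the three faces of the hexagon and the other ones. -/
noncomputable def faceEquiv (h : IsCubeFlip G G' L) : Fin 3 ⊕ OtherFace L ≃ F :=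
  Equiv.ofBijective (Sum.elim ![L.fX, L.fY, L.fZ] Subtype.val) <| by
    constructor
    · refine h.faces_injective.sumElim Subtype.val_injective ?_
      rintro j ⟨f, hf⟩ rfl
      fin_cases j
      exacts [hf.1 rfl, hf.2.1 rfl, hf.2.2 rfl]
    · intro f
      by_cases hf : f ≠ L.fX ∧ f ≠ L.fY ∧ f ≠ L.fZ
      · exact ⟨.inr ⟨f, hf⟩, rfl⟩
      · have : f = L.fX ∨ f = L.fY ∨ f = L.fZ := by tauto
        rcases this with rfl | rfl | rfl
        exacts [⟨.inl 0, rfl⟩, ⟨.inl 1, rfl⟩, ⟨.inl 2, rfl⟩]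

/-- A quadrangulation is relabelled such that the corners of the three faces of the hexagon are
listed in a given order. -/
theorem exists_relabel {G₁ : Quadrangulation V F} {φ : Fin 3 ⊕ OtherFace L ≃ F}
    {c : Fin 3 → Fin 4 → V}
    (hc : ∀ j, ∃ k : Fin 4, ∀ i, G₁.corner (φ (.inl j)) (i + k) = c j i) :
    ∃ k, (∀ j, (G₁.relabel φ k).corner (.inl j) = c j) ∧
      ∀ f, (G₁.relabel φ k).corner (.inr f) = G₁.corner (φ (.inr f)) := by
  choose k hk using hc
  refine ⟨Sum.elim k 0, fun j => funext fun i => hk j i, fun f => funext fun i => ?_⟩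
  simp [Quadrangulation.relabel]

end IsCubeFlip

open Quadrangulation in
theorem theorem3p3 {V F : Type*} [Finite V] [DecidableEq V] [Fintype F] [DecidableEq F]
    (G G' : Quadrangulation V F) (L : CubeLabels V F) (hflip : IsCubeFlip G G' L)
    (g : V → ℝ) (hg : ∀ v, 0 < g v) (gx' : ℝ) (hgx' : 0 < gx') :
    (KashaevRecurrence (g L.x) (g L.v1) (g L.v2) (g L.v3) (g L.v12) (g L.v13) (g L.v23) gx' →
      ∀ B : BoundaryCondition V,
        1 / (g L.x) ^ 2 * G.markedPartitionFunction B g =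
          1 / gx' ^ 2 * G'.markedPartitionFunction B (Function.update g L.x gx')) ∧
    -- If the three faces of the hexagon are the only internal faces, then the equations for all
    -- boundary conditions are the Yang-Baxter equations.
    ((∀ f, f = L.fX ∨ f = L.fY ∨ f = L.fZ) →
      ((∀ B : BoundaryCondition V,
        1 / (g L.x) ^ 2 * G.markedPartitionFunction B g =
          1 / gx' ^ 2 * G'.markedPartitionFunction B (Function.update g L.x gx')) ↔
      KashaevRecurrence (g L.x) (g L.v1) (g L.v2) (g L.v3) (g L.v12) (g L.v13) (g L.v23) gx')) := by
  have hn := hflip.nodup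
  simp only [List.nodup_cons, List.mem_cons, not_or, List.not_mem_nil, List.nodup_nil] at hn
  have hφ0 : hflip.faceEquiv (.inl 0) = L.fX := rfl
  have hφ1 : hflip.faceEquiv (.inl 1) = L.fY := rfl
  have hφ2 : hflip.faceEquiv (.inl 2) = L.fZ := rfl
  have hφr : ∀ f, hflip.faceEquiv (.inr f) = f.1 := fun _ => rfl
  generalize hflip.faceEquiv = φ at *
  obtain ⟨k, hc, hr⟩ := IsCubeFlip.exists_relabel (G₁ := G) (φ := φ)
    (c := ![![L.x, L.v3, L.v23, L.v2], ![L.x, L.v1, L.v13, L.v3], ![L.x, L.v2, L.v12, L.v1]]) (by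
      rw [Fin.forall_fin_succ, Fin.forall_fin_succ, Fin.forall_fin_succ]
      exact ⟨hφ0 ▸ hflip.cornersX, hφ1 ▸ hflip.cornersY, hφ2 ▸ hflip.cornersZ, fun j => j.elim0⟩)
  obtain ⟨k', hc', hr'⟩ := IsCubeFlip.exists_relabel (G₁ := G') (φ := φ)
    (c := ![![L.x, L.v12, L.v1, L.v13], ![L.x, L.v23, L.v2, L.v12], ![L.x, L.v13, L.v3, L.v23]]) (by
      rw [Fin.forall_fin_succ, Fin.forall_fin_succ, Fin.forall_fin_succ]
      exact ⟨hφ0 ▸ hflip.cornersX', hφ1 ▸ hflip.cornersY', hφ2 ▸ hflip.cornersZ',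
        fun j => j.elim0⟩)
  have hadj : ∀ v, (G.relabel φ k).graph.Adj L.x v → v = L.v1 ∨ v = L.v2 ∨ v = L.v3 :=
    fun v => (hflip.adj_center v).1
  have hZ : ∀ B, G.markedPartitionFunction B g = (G.relabel φ k).markedPartitionFunction B g :=
    fun B => (G.markedPartitionFunction_relabel φ k B g).symm
  have hZ' : ∀ B, G'.markedPartitionFunction B (Function.update g L.x gx') =
      (G'.relabel φ k').markedPartitionFunction B (Function.update g L.x gx') :=
    fun B => (G'.markedPartitionFunction_relabel φ k' B _).symm
  have hrr : ∀ f, (G'.relabel φ k').corner (.inr f) = (G.relabel φ k).corner (.inr f) := by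
    intro f
    rw [hr, hr', hφr]
    exact hflip.corner_other _ f.2.1 f.2.2.1 f.2.2.2
  simp only [hZ, hZ']
  generalize G.relabel φ k = H at *
  generalize G'.relabel φ k' = H' at *
  clear hZ hZ' hr hr'
  have hstar : H.IsStar := ⟨L.x, fun j => by rw [hc, hc]; fin_cases j <;> exact ⟨rfl, rfl⟩⟩
  have hstar' : H'.IsStar := ⟨L.x, fun j => by rw [hc', hc']; fin_cases j <;> exact ⟨rfl, rfl⟩⟩
  have hne : ∀ f i, H.corner (.inr f) i ≠ L.x := by
    refine IsStar.corner_inr_ne (fun j => by rw [hc]; fin_cases j <;> rfl) fun v hv => ?_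
    rcases hadj v hv with rfl | rfl | rfl
    exacts [⟨1, by rw [hc]; rfl⟩, ⟨2, by rw [hc]; rfl⟩, ⟨0, by rw [hc]; rfl⟩]
  have fin3 : ∀ j : Fin 3, j = 0 ∨ j = 1 ∨ j = 2 := by decide
  have fin2 : ∀ j : Fin 2, j = 0 ∨ j = 1 := by decide
  let sd : OuterSide (IsCubeFlip.OtherFace L) → V × V :=
    fun s => H.side (outerSide (Equiv.refl HexSide) s)
  -- The half-turn matches the two stars: each oriented side of the hexagon is the same edge of the
  -- graph before and after the flip.
  have hsd' : ∀ s, sd s = H'.side (outerSide hexFlip s) := by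
    rintro (⟨j, i⟩ | ⟨f, i⟩)
    · rcases fin3 j with rfl | rfl | rfl <;> rcases fin2 i with rfl | rfl
      · change (H.corner (.inl 0) 1, H.corner (.inl 0) 2) =
          (H'.corner (.inl 2) 2, H'.corner (.inl 2) 3)
        rw [hc, hc']
        rfl
      · change (H.corner (.inl 0) 2, H.corner (.inl 0) 3) =
          (H'.corner (.inl 1) 1, H'.corner (.inl 1) 2)
        rw [hc, hc']
        rfl
      · change (H.corner (.inl 1) 1, H.corner (.inl 1) 2) =
          (H'.corner (.inl 0) 2, H'.corner (.inl 0) 3)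
        rw [hc, hc']
        rfl
      · change (H.corner (.inl 1) 2, H.corner (.inl 1) 3) =
          (H'.corner (.inl 2) 1, H'.corner (.inl 2) 2)
        rw [hc, hc']
        rfl
      · change (H.corner (.inl 2) 1, H.corner (.inl 2) 2) =
          (H'.corner (.inl 1) 2, H'.corner (.inl 1) 3)
        rw [hc, hc']
        rfl
      · change (H.corner (.inl 2) 2, H.corner (.inl 2) 3) =
          (H'.corner (.inl 0) 1, H'.corner (.inl 0) 2)
        rw [hc, hc']
        rfl
    · simp only [sd, side, outerSide, Sum.elim_inr, hrr]
  have hupd : ∀ v, v ≠ L.x → Function.update g L.x gx' v = g v :=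
    fun v hv => Function.update_of_ne hv _ _
  have hW : ∀ j c, H.faceWeight g (.inl j) c = cubeWeights √(g L.x)
      ![√(g L.v1), √(g L.v2), √(g L.v3)] ![√(g L.v23), √(g L.v13), √(g L.v12)]
      ![√(g L.x * g L.v23 + g L.v3 * g L.v2), √(g L.x * g L.v13 + g L.v1 * g L.v3),
        √(g L.x * g L.v12 + g L.v2 * g L.v1)] j c.kind := by
    intro j c
    rw [faceWeight, LocalConf.weight_eq_kindWeights c (hg _) (hg _) (hg _) (hg _), hc]
    fin_cases j <;> rfl
  have hW' : ∀ j c, H'.faceWeight (Function.update g L.x gx') (.inl j) c = cubeWeights √gx'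
      ![√(g L.v23), √(g L.v13), √(g L.v12)] ![√(g L.v1), √(g L.v2), √(g L.v3)]
      ![√(gx' * g L.v1 + g L.v12 * g L.v13), √(gx' * g L.v2 + g L.v23 * g L.v12),
        √(gx' * g L.v3 + g L.v13 * g L.v23)] j c.kind := by
    intro j c
    have h0 : ∀ v, 0 < Function.update g L.x gx' v := by
      intro v
      rcases eq_or_ne v L.x with rfl | hv
      · rwa [Function.update_self]
      · rw [hupd v hv]; exact hg v
    rw [faceWeight, LocalConf.weight_eq_kindWeights c (h0 _) (h0 _) (h0 _) (h0 _), hc']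
    have e1 := hupd L.v1 (by grind)
    have e2 := hupd L.v2 (by grind)
    have e3 := hupd L.v3 (by grind)
    have e12 := hupd L.v12 (by grind)
    have e13 := hupd L.v13 (by grind)
    have e23 := hupd L.v23 (by grind)
    have e0 : Function.update g L.x gx' L.x = gx' := Function.update_self _ _ _
    generalize Function.update g L.x gx' = u at *
    rcases fin3 j with rfl | rfl | rfl
    · change kindWeights (√(u L.x) * √(u L.v1)) (√(u L.v13) * √(u L.v12))
        √(u L.x * u L.v1 + u L.v12 * u L.v13) _ = _
      rw [e0, e1, e12, e13]
      rfl
    · change kindWeights (√(u L.x) * √(u L.v2)) (√(u L.v12) * √(u L.v23))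
        √(u L.x * u L.v2 + u L.v23 * u L.v12) _ = _
      rw [e0, e2, e12, e23]
      rfl
    · change kindWeights (√(u L.x) * √(u L.v3)) (√(u L.v23) * √(u L.v13))
        √(u L.x * u L.v3 + u L.v13 * u L.v23) _ = _
      rw [e0, e3, e13, e23]
      rfl
  have hout : ∀ f c, H'.faceWeight (Function.update g L.x gx') (.inr f) c =
      H.faceWeight g (.inr f) c := by
    intro f c
    simp only [faceWeight, hrr, hupd _ (hne f _)]
  have hkash : KashaevRecurrence (g L.x) (g L.v1) (g L.v2) (g L.v3) (g L.v12) (g L.v13) (g L.v23)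
      gx' → ∀ B : BoundaryCondition V, 1 / (g L.x) ^ 2 * H.markedPartitionFunction B g =
        1 / gx' ^ 2 * H'.markedPartitionFunction B (Function.update g L.x gx') := by
    intro h B
    have hcube := h.isKashaevCube (hg _) (hg _) (hg _) (hg _) (hg _) (hg _) (hg _) hgx'
    rw [hstar.markedPartitionFunction_eq (Equiv.refl _) (fun _ => rfl),
      hstar'.markedPartitionFunction_eq hexFlip hsd', Finset.mul_sum, Finset.mul_sum]
    refine Finset.sum_congr rfl fun o _ => ?_
    simp only [hout, funext₂ hW, funext₂ hW']
    rw [mul_left_comm, mul_left_comm (1 / gx' ^ 2)]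
    refine congrArg _ ?_
    have := hexagonSum_flip hcube.classSum_eq fun b M => OuterCondition sd o.1 o.2 b M B
    rwa [Real.sq_sqrt (hg _).le, Real.sq_sqrt hgx'.le] at this
  refine ⟨hkash, fun hall => ⟨fun hB => ?_, hkash⟩⟩
  have hempty : IsEmpty (IsCubeFlip.OtherFace L) := ⟨fun f => by
    rcases hall f.1 with h | h | h
    exacts [f.2.1 h, f.2.2.1 h, f.2.2.2 h]⟩
  have hinj : Function.Injective sd := H.side_injective.comp (outerSide_injective _)
  -- As the vertices are distinct, no side of the hexagon is the reverse of another, so all six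
  -- sides are external.
  have hext : ∀ s t, sd t ≠ (sd s).swap := by
    have hside : ∀ s, sd s ∈ [(L.v3, L.v23), (L.v23, L.v2), (L.v1, L.v13), (L.v13, L.v3),
        (L.v2, L.v12), (L.v12, L.v1)] := by
      rintro (⟨j, i⟩ | ⟨f, i⟩)
      · have hcc : ∀ i' : Fin 4, sd (.inl (j, i)) = (H.corner (.inl j) (![1, 2] i),
          H.corner (.inl j) (![1, 2] i + 1)) := fun _ => rfl
        rw [hcc 0, hc]
        rcases fin3 j with rfl | rfl | rfl <;> rcases fin2 i with rfl | rfl <;> simp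
      · exact isEmptyElim f
    intro s t h
    have hs := hside s
    have ht := hside t
    rw [h] at ht
    simp only [List.mem_cons, List.not_mem_nil, or_false, Prod.ext_iff, Prod.fst_swap,
      Prod.snd_swap] at hs ht
    grind
  -- Class 4 pairs the two sides of each old face. The half-turn sends it to class 0, which contains
  -- only the shapes `(.one, .one, .one)`.
  have h := hB (hexBoundaryCondition (fun e => sd (.inl e)) 4)
  rw [hstar.markedPartitionFunction_eq (Equiv.refl _) (fun _ => rfl),
    hstar'.markedPartitionFunction_eq hexFlip hsd', Fintype.sum_prod_type, Fintype.sum_prod_type,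
    Fintype.sum_unique, Fintype.sum_unique, Fintype.sum_unique, Fintype.sum_unique] at h
  simp only [Finset.univ_eq_empty, Finset.prod_empty, one_mul, funext₂ hW, funext₂ hW'] at h
  rw [hexagonSum_eq_classSum (k₀ := 4) (by decide +kernel), hexagonSum_eq_classSum (k₀ := 0)
    (by decide +kernel)] at h
  · exact kashaevRecurrence_of_classSum_eq (hg _) (hg _) (hg _) (hg _) (hg _) (hg _) (hg _) hgx' h
  · intro b l
    obtain ⟨l, rfl⟩ := flipClass.surjective l
    simp only [hexRel_flipClass]
    change OuterCondition sd _ _ _ (HexRel l) _ ↔ _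
    rw [outerCondition_hexBoundaryCondition hinj hext]
    refine and_congr ?_ flipClass.apply_eq_iff_eq.symm
    constructor
    · intro hb
      funext e
      have := congrFun hb (hexFlip.symm e)
      rwa [Function.comp_apply, Equiv.apply_symm_apply] at this
    · rintro rfl
      rfl
  · intro b l
    exact outerCondition_hexBoundaryCondition hinj hext _ _ _ _ _
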